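/- All rings are commutative with unit. For an ideal $I$ of a ring $A$ and $r\in A$, let $q(r)\in\mathbb N\cup\{\infty\}$ be the largest $n$ with $r\in I^n$ (or $\infty$ if there is no largest one), let $\bar q(r)=\lim_{n\to\infty} q(r^n)/n\in[0,\infty]$ (this limit exists), and let $$\overline{gr}_I A=\bigoplus_{\alpha\in\mathbb Q_{\ge 0}}\{r\in A:\bar q(r)\ge\alpha\}\,/\,\{r\in A:\bar q(r)>\alpha\}$$ be the balanced associated graded ring, with the multiplication induced from $A$. A ring homomorphism $A\to A'$ taking $I$ into $I'$ induces a graded ring homomorphism $\overline{gr}_I A\to\overline{gr}_{I'}A'$. For an element $c$ of a ring $A$, the integral closure of $A/\mathrm{ann}(c)$ in $A[c^{-1}]$ means the ring of all elements of $A[c^{-1}]$ that are integral over $A/\mathrm{ann}(c)$ along the natural homomorphism $A/\mathrm{ann}(c)\to A[c^{-1}]$. Let $R$ be a Noetherian ring and $b\in R$. Write $\overline{gr}\,R=\overline{gr}_{\langle b\rangle}R$, and write $b$ also for the element of degree $1$ of $\overline{gr}\,R$ that $b$ represents. Let $\tilde R$ be the integral closure of $R/\mathrm{ann}(b)$ in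 $R[b^{-1}]$, let $\overline{gr}\,\tilde R=\overline{gr}_{b\tilde R}\tilde R$, and let $\widetilde{gr}\,R$ be the integral closure of $\overline{gr}\,R/\mathrm{ann}(b)$ in $\overline{gr}\,R[b^{-1}]$, where $\overline{gr}\,R[b^{-1}]$ is graded by giving $y/b^k$ degree $\alpha$ when $y$ is homogeneous of degree $\alpha+k$. Then there is an isomorphism of rings $\varphi:\overline{gr}\,\tilde R\to\widetilde{gr}\,R$. Moreover $\varphi$ can be chosen such that, for every $\alpha\in\mathbb Q_{\ge0}$, an element $x\in\overline{gr}\,\tilde R$ is homogeneous of degree $\alpha$ if and only if $\varphi(x)$ is, and such that the composite of $\varphi$ with the map $\overline{gr}\,R\to\overline{gr}\,\tilde R$ induced by $R\to\tilde R$ is the natural map $\overline{gr}\,R\to\widetilde{gr}\,R$. In other words, integral closure commutes with the balanced associated graded. -/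

import Mathlib

namespace BalancedGr

open Filter Topology
open scoped NNReal ENNReal DirectSum

section Order

variable {R : Type*} [CommRing R] (I : Ideal R)

/-- `q(r)`: the largest `n` with `r ∈ I ^ n`, or `∞` if there is no largest one. -/
noncomputable def adicOrder (r : R) : ℕ∞ := ⨆ (n : ℕ) (_ : r ∈ I ^ n), (n : ℕ∞)

/-- The homogenization `q̄(r) = lim q(r ^ n) / n`, with values in `[0, ∞]`.  It is written as a
limsup; `tendsto_qbar` below shows that the limit exists and has this value. -/
noncomputable def qbar (r : R) : ℝ≥0∞ :=
  limsup (fun n : ℕ => ((adicOrder I (r ^ n) : ℕ∞) : ℝ≥0∞) / (n : ℝ≥0∞)) atTop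

variable {I}

theorem coe_le_adicOrder {r : R} {n : ℕ} : (n : ℕ∞) ≤ adicOrder I r ↔ r ∈ I ^ n := by
  constructor
  · intro h
    by_contra hr
    have hn : n ≠ 0 := by
      rintro rfl
      simp at hr
    have h2 : adicOrder I r ≤ ((n - 1 : ℕ) : ℕ∞) := by
      refine iSup₂_le fun k hk => ?_
      have : k < n := by
        by_contra hkn
        exact hr (Ideal.pow_le_pow_right (not_lt.mp hkn) hk)
      exact_mod_cast (by omega : k ≤ n - 1)
    have h3 : n ≤ n - 1 := by exact_mod_cast h.trans h2
    omega
  · intro h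
    exact le_iSup₂ (f := fun (n : ℕ) (_ : r ∈ I ^ n) => (n : ℕ∞)) n h

theorem le_adicOrder_mul (r s : R) : adicOrder I r + adicOrder I s ≤ adicOrder I (r * s) := by
  refine ENat.forall_natCast_le_iff_le.mp fun n hn => ?_
  rw [coe_le_adicOrder]
  by_cases h1 : adicOrder I r = ⊤
  · have : r ∈ I ^ n := coe_le_adicOrder.mp (by rw [h1]; exact le_top)
    exact Ideal.mul_mem_right _ _ this
  by_cases h2 : adicOrder I s = ⊤
  · have : s ∈ I ^ n := coe_le_adicOrder.mp (by rw [h2]; exact le_top)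
    exact Ideal.mul_mem_left _ _ this
  obtain ⟨a, ha⟩ := ENat.ne_top_iff_exists.mp h1
  obtain ⟨c, hc⟩ := ENat.ne_top_iff_exists.mp h2
  rw [← ha, ← hc] at hn
  have hn' : n ≤ a + c := by exact_mod_cast hn
  have hr : r ∈ I ^ a := coe_le_adicOrder.mp ha.le
  have hs : s ∈ I ^ c := coe_le_adicOrder.mp hc.le
  refine Ideal.pow_le_pow_right hn' ?_
  rw [pow_add]
  exact Ideal.mul_mem_mul hr hs

theorem div_le_liminf {r : R} {m p : ℕ} (hm : 0 < m) (h : r ^ m ∈ I ^ p) :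
    (p : ℝ≥0∞) / m ≤
      liminf (fun n : ℕ => ((adicOrder I (r ^ n) : ℕ∞) : ℝ≥0∞) / (n : ℝ≥0∞)) atTop := by
  have hlim : Tendsto (fun n : ℕ => ENNReal.ofReal ((p : ℝ) * ((1 / m : ℝ) - 1 / n)))
      atTop (𝓝 (ENNReal.ofReal ((p : ℝ) * ((1 / m : ℝ) - 0)))) := by
    refine ENNReal.tendsto_ofReal ?_
    exact (tendsto_const_nhds.sub tendsto_one_div_atTop_nhds_zero_nat).const_mul _
  have heq : (p : ℝ≥0∞) / m = ENNReal.ofReal ((p : ℝ) * ((1 / m : ℝ) - 0)) := by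
    rw [sub_zero, mul_one_div, ENNReal.ofReal_div_of_pos (by exact_mod_cast hm)]
    simp
  rw [heq, ← hlim.liminf_eq]
  refine liminf_le_liminf ?_
  filter_upwards [eventually_gt_atTop 0] with n hn
  have hmem : r ^ n ∈ I ^ (p * (n / m)) := by
    have h1 : (r ^ m) ^ (n / m) ∈ I ^ (p * (n / m)) := by
      rw [pow_mul]
      exact Ideal.pow_mem_pow h _
    have h2 : r ^ n = (r ^ m) ^ (n / m) * r ^ (n % m) := by
      rw [← pow_mul, ← pow_add, Nat.div_add_mod]
    rw [h2]
    exact Ideal.mul_mem_right _ _ h1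
  have h3 : ((p * (n / m) : ℕ) : ℝ≥0∞) ≤ ((adicOrder I (r ^ n) : ℕ∞) : ℝ≥0∞) := by
    exact_mod_cast ENat.toENNReal_le.mpr (coe_le_adicOrder.mpr hmem)
  refine le_trans ?_ (ENNReal.div_le_div_right h3 _)
  have hn' : (0 : ℝ) < n := by exact_mod_cast hn
  have hm' : (0 : ℝ) < m := by exact_mod_cast hm
  have h4 : ((p * (n / m) : ℕ) : ℝ≥0∞) / n =
      ENNReal.ofReal (((p * (n / m) : ℕ) : ℝ) / n) := by
    rw [ENNReal.ofReal_div_of_pos hn']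
    simp only [ENNReal.ofReal_natCast]
  rw [h4]
  refine ENNReal.ofReal_le_ofReal ?_
  rw [Nat.cast_mul, mul_div_assoc]
  refine mul_le_mul_of_nonneg_left ?_ (Nat.cast_nonneg _)
  have h5 : (n : ℝ) < m * ((n / m : ℕ) + 1) := by
    exact_mod_cast Nat.lt_mul_div_succ n hm
  rw [div_sub_div _ _ hm'.ne' hn'.ne', div_le_div_iff₀ (by positivity) hn']
  nlinarith

theorem exists_of_lt_limsup {r : R} {x : ℝ≥0∞} (h : x < qbar I r) :
    ∃ m p : ℕ, 0 < m ∧ r ^ m ∈ I ^ p ∧ x < (p : ℝ≥0∞) / m := by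
  have h1 := frequently_lt_of_lt_limsup (by isBoundedDefault) h
  obtain ⟨m, hm, hx⟩ := (h1.and_eventually (eventually_gt_atTop 0)).exists.imp
    fun _ h => And.intro h.2 h.1
  have hm0 : (m : ℝ≥0∞) ≠ 0 := by exact_mod_cast hm.ne'
  by_cases htop : adicOrder I (r ^ m) = ⊤
  · have hxm : x * m ≠ ⊤ := ENNReal.mul_ne_top hx.ne_top (ENNReal.natCast_ne_top m)
    obtain ⟨p, hp⟩ := ENNReal.exists_nat_gt hxm
    refine ⟨m, p, hm, coe_le_adicOrder.mp (by rw [htop]; exact le_top), ?_⟩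
    rw [ENNReal.lt_div_iff_mul_lt (Or.inl hm0) (Or.inl (ENNReal.natCast_ne_top m))]
    exact hp
  · obtain ⟨p, hp⟩ := ENat.ne_top_iff_exists.mp htop
    refine ⟨m, p, hm, coe_le_adicOrder.mp hp.le, ?_⟩
    rw [← hp] at hx
    exact_mod_cast hx

theorem div_le_qbar {r : R} {m p : ℕ} (hm : 0 < m) (h : r ^ m ∈ I ^ p) :
    (p : ℝ≥0∞) / m ≤ qbar I r :=
  (div_le_liminf hm h).trans (liminf_le_limsup)

variable (I) in
/-- The limit defining `q̄` exists. -/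
theorem tendsto_qbar (r : R) :
    Tendsto (fun n : ℕ => ((adicOrder I (r ^ n) : ℕ∞) : ℝ≥0∞) / (n : ℝ≥0∞)) atTop
      (𝓝 (qbar I r)) := by
  refine tendsto_of_le_liminf_of_limsup_le ?_ le_rfl
  refine le_of_forall_lt fun x hx => ?_
  obtain ⟨m, p, hm, hr, hlt⟩ := exists_of_lt_limsup hx
  exact hlt.trans_le (div_le_liminf hm hr)

theorem le_qbar_mul (r s : R) : qbar I r + qbar I s ≤ qbar I (r * s) := by
  refine le_of_tendsto_of_tendsto' ((tendsto_qbar I r).add (tendsto_qbar I s))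
    (tendsto_qbar I (r * s)) fun n => ?_
  rw [← ENNReal.add_div, mul_pow]
  refine ENNReal.div_le_div_right ?_ _
  have := ENat.toENNReal_le.mpr (le_adicOrder_mul (I := I) (r ^ n) (s ^ n))
  simpa using this

theorem le_qbar_add (r s : R) : min (qbar I r) (qbar I s) ≤ qbar I (r + s) := by
  refine le_of_forall_lt fun x hx => ?_
  obtain ⟨m, p, hm, hr, hxr⟩ := exists_of_lt_limsup (lt_min_iff.mp hx).1
  obtain ⟨n, k, hn, hs, hxs⟩ := exists_of_lt_limsup (lt_min_iff.mp hx).2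
  set M := m * n with hM
  have hMpos : 0 < M := Nat.mul_pos hm hn
  set P := min (p * n) (k * m) with hP
  have hr' : r ^ M ∈ I ^ P := by
    refine Ideal.pow_le_pow_right (min_le_left _ _) ?_
    rw [hM, pow_mul, pow_mul]
    exact Ideal.pow_mem_pow hr _
  have hs' : s ^ M ∈ I ^ P := by
    refine Ideal.pow_le_pow_right (min_le_right _ _) ?_
    rw [hM, mul_comm m n, pow_mul, pow_mul]
    exact Ideal.pow_mem_pow hs _
  have hxP : x < (P : ℝ≥0∞) / M := by
    have h1 : (p : ℝ≥0∞) / m = ((p * n : ℕ) : ℝ≥0∞) / M := by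
      rw [hM]
      push_cast
      rw [ENNReal.mul_div_mul_right _ _ (by exact_mod_cast hn.ne') (ENNReal.natCast_ne_top n)]
    have h2 : (k : ℝ≥0∞) / n = ((k * m : ℕ) : ℝ≥0∞) / M := by
      rw [hM, mul_comm m n]
      push_cast
      rw [ENNReal.mul_div_mul_right _ _ (by exact_mod_cast hm.ne') (ENNReal.natCast_ne_top m)]
    rcases min_choice (p * n) (k * m) with h | h
    · rw [hP, h, ← h1]; exact hxr
    · rw [hP, h, ← h2]; exact hxs
  have hkey : ∀ L : ℕ, (r + s) ^ (M * (L + 1)) ∈ I ^ (P * L) := by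
    have haux : ∀ (t : R), t ^ M ∈ I ^ P → ∀ i, t ^ i ∈ I ^ (P * (i / M)) := by
      intro t ht i
      have h1 : (t ^ M) ^ (i / M) ∈ I ^ (P * (i / M)) := by
        rw [pow_mul]
        exact Ideal.pow_mem_pow ht _
      have h2 : t ^ i = (t ^ M) ^ (i / M) * t ^ (i % M) := by
        rw [← pow_mul, ← pow_add, Nat.div_add_mod]
      rw [h2]
      exact Ideal.mul_mem_right _ _ h1
    intro L
    rw [add_pow]
    refine Ideal.sum_mem _ fun i hi => Ideal.mul_mem_right _ _ ?_
    have hi' : i ≤ M * (L + 1) := by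
      have := Finset.mem_range.mp hi
      omega
    have h1 := Ideal.mul_mem_mul (haux r hr' i) (haux s hs' (M * (L + 1) - i))
    rw [← pow_add, ← mul_add] at h1
    refine Ideal.pow_le_pow_right (Nat.mul_le_mul_left _ ?_) h1
    set j := M * (L + 1) - i with hj
    have hij : i + j = M * (L + 1) := by omega
    have e1 := Nat.lt_mul_div_succ i hMpos
    have e2 := Nat.lt_mul_div_succ j hMpos
    have e3 : M * (L + 1) < M * ((i / M + 1) + (j / M + 1)) := by
      rw [← hij, mul_add]
      exact add_lt_add e1 e2
    have e4 := Nat.lt_of_mul_lt_mul_left e3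
    omega
  have hlim : Tendsto (fun L : ℕ => ((P * L : ℕ) : ℝ≥0∞) / ((M * (L + 1) : ℕ) : ℝ≥0∞)) atTop
      (𝓝 ((P : ℝ≥0∞) / M)) := by
    have hMr : (0 : ℝ) < M := by exact_mod_cast hMpos
    have h1 : Tendsto (fun L : ℕ => ENNReal.ofReal ((P / M : ℝ) * ((L : ℝ) / (L + 1)))) atTop
        (𝓝 (ENNReal.ofReal ((P / M : ℝ) * 1))) :=
      ENNReal.tendsto_ofReal ((tendsto_natCast_div_add_atTop (1 : ℝ)).const_mul _)
    have h2 : ENNReal.ofReal ((P / M : ℝ) * 1) = (P : ℝ≥0∞) / M := by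
      rw [mul_one, ENNReal.ofReal_div_of_pos hMr]
      simp
    rw [h2] at h1
    refine h1.congr fun L => ?_
    have hL : (0 : ℝ) < ((M * (L + 1) : ℕ) : ℝ) := by positivity
    rw [div_mul_div_comm, show (M : ℝ) * ((L : ℝ) + 1) = ((M * (L + 1) : ℕ) : ℝ) by push_cast; ring,
      ENNReal.ofReal_div_of_pos hL, ENNReal.ofReal_natCast,
      show (P : ℝ) * (L : ℝ) = ((P * L : ℕ) : ℝ) by push_cast; ring, ENNReal.ofReal_natCast]
  refine hxP.trans_le (le_of_tendsto' hlim fun L => ?_)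
  exact div_le_qbar (Nat.mul_pos hMpos (Nat.succ_pos L)) (hkey L)

theorem qbar_zero : qbar I (0 : R) = ⊤ := by
  refine ENNReal.eq_top_of_forall_nnreal_le fun x => ?_
  obtain ⟨p, hp⟩ := exists_nat_gt x
  have h := div_le_qbar (I := I) (r := 0) (m := 1) (p := p) one_pos (by simp)
  refine le_trans ?_ h
  simp only [Nat.cast_one, div_one]
  exact_mod_cast hp.le

theorem one_le_qbar {r : R} (h : r ∈ I) : 1 ≤ qbar I r := by
  simpa using div_le_qbar (I := I) (r := r) (m := 1) (p := 1) one_pos (by simpa using h)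

theorem qbar_le_map {S : Type*} [CommRing S] {J : Ideal S} (f : R →+* S) (hf : I.map f ≤ J)
    (r : R) : qbar I r ≤ qbar J (f r) := by
  refine le_of_forall_lt fun x hx => ?_
  obtain ⟨m, p, hm, hr, hlt⟩ := exists_of_lt_limsup hx
  refine hlt.trans_le (div_le_qbar hm ?_)
  rw [← map_pow]
  have h1 := Ideal.mem_map_of_mem f hr
  rw [Ideal.map_pow] at h1
  exact Ideal.pow_right_mono hf p h1

end Order

section Ogr

variable {R : Type*} [CommRing R] (I : Ideal R)

/-- The ideal `{r : q̄(r) ≥ α}`. -/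
noncomputable def filtGE (α : ℚ≥0) : Ideal R where
  carrier := {r | ((α : ℝ≥0) : ℝ≥0∞) ≤ qbar I r}
  add_mem' {r s} hr hs := (le_min hr hs).trans (le_qbar_add r s)
  zero_mem' := by simp [qbar_zero]
  smul_mem' c r hr := le_trans (le_trans hr le_add_self) (le_qbar_mul c r)

/-- The ideal `{r : q̄(r) > α}`. -/
noncomputable def filtGT (α : ℚ≥0) : Ideal R where
  carrier := {r | ((α : ℝ≥0) : ℝ≥0∞) < qbar I r}
  add_mem' {r s} hr hs := (lt_min hr hs).trans_le (le_qbar_add r s)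
  zero_mem' := by simp [qbar_zero]
  smul_mem' c r hr := lt_of_lt_of_le (lt_of_lt_of_le hr le_add_self) (le_qbar_mul c r)

variable {I}

theorem filtGE_mul_mem {α β : ℚ≥0} {r s : R} (hr : r ∈ filtGE I α) (hs : s ∈ filtGE I β) :
    r * s ∈ filtGE I (α + β) := by
  refine le_trans ?_ (le_qbar_mul r s)
  push_cast
  exact add_le_add hr hs

theorem filtGT_mul_mem {α β : ℚ≥0} {r s : R} (hr : r ∈ filtGT I α) (hs : s ∈ filtGE I β) :
    r * s ∈ filtGT I (α + β) := by
  refine lt_of_lt_of_le ?_ (le_qbar_mul r s)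
  push_cast
  exact ENNReal.add_lt_add_of_lt_of_le ENNReal.coe_ne_top hr hs

theorem mem_filtGE_zero (r : R) : r ∈ filtGE I 0 := by
  change (((0 : ℚ≥0) : ℝ≥0) : ℝ≥0∞) ≤ qbar I r
  simp

variable (I)

/-- The graded piece `{r : q̄(r) ≥ α} / {r : q̄(r) > α}`. -/
abbrev Piece (α : ℚ≥0) : Type _ := filtGE I α ⧸ (filtGT I α).submoduleOf (filtGE I α)

/-- The class in degree `α` of an element `r` with `q̄(r) ≥ α`. -/
noncomputable def Piece.mk (α : ℚ≥0) : filtGE I α →ₗ[R] Piece I α := Submodule.mkQ _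

variable {I}

theorem Piece.mk_surjective (α : ℚ≥0) : Function.Surjective (Piece.mk I α) :=
  Submodule.mkQ_surjective _

theorem Piece.mk_eq_mk {α : ℚ≥0} {r s : filtGE I α} :
    Piece.mk I α r = Piece.mk I α s ↔ (r : R) - s ∈ filtGT I α :=
  Submodule.Quotient.eq _

/-- Multiplication of graded pieces: the class of `r` times the class of `s` is the class of
`r * s`. -/
noncomputable def Piece.mul {α β : ℚ≥0} : Piece I α → Piece I β → Piece I (α + β) :=
  Quotient.map₂ (fun r s => ⟨(r : R) * s, filtGE_mul_mem r.2 s.2⟩) (by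
    intro r r' hr s s' hs
    have hr' : (r : R) - r' ∈ filtGT I α :=
      (Submodule.quotientRel_def ((filtGT I α).submoduleOf (filtGE I α))).mp hr
    have hs' : (s : R) - s' ∈ filtGT I β :=
      (Submodule.quotientRel_def ((filtGT I β).submoduleOf (filtGE I β))).mp hs
    refine (Submodule.quotientRel_def _).mpr ?_
    change (r : R) * s - r' * s' ∈ filtGT I (α + β)
    have h1 := filtGT_mul_mem hr' s.2
    have h2 := filtGT_mul_mem hs' r'.2
    rw [add_comm β α] at h2
    have h3 := (filtGT I (α + β)).add_mem h1 h2
    convert h3 using 1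
    ring)

theorem Piece.mul_mk {α β : ℚ≥0} (r : filtGE I α) (s : filtGE I β) :
    Piece.mul (Piece.mk I α r) (Piece.mk I β s) =
      Piece.mk I (α + β) ⟨(r : R) * s, filtGE_mul_mem r.2 s.2⟩ := rfl

theorem Piece.sigma_eq {α β : ℚ≥0} (h : α = β) {r : filtGE I α} {s : filtGE I β}
    (hrs : (r : R) = s) :
    (⟨α, Piece.mk I α r⟩ : GradedMonoid (Piece I)) = ⟨β, Piece.mk I β s⟩ := by
  subst h
  rw [Subtype.ext hrs]

noncomputable instance Piece.gMul : GradedMonoid.GMul (Piece I) where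
  mul := Piece.mul

noncomputable instance Piece.gOne : GradedMonoid.GOne (Piece I) where
  one := Piece.mk I 0 ⟨1, mem_filtGE_zero 1⟩

noncomputable instance Piece.gCommRing : DirectSum.GCommRing (Piece I) where
  mul := Piece.mul
  one := Piece.mk I 0 ⟨1, mem_filtGE_zero 1⟩
  mul_zero {α β} a := by
    obtain ⟨r, rfl⟩ := Piece.mk_surjective α a
    rw [← map_zero (Piece.mk I β)]
    change Piece.mul _ _ = _
    rw [Piece.mul_mk, ← map_zero (Piece.mk I (α + β))]
    congr 1
    ext
    simp
  zero_mul {α β} a := by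
    obtain ⟨r, rfl⟩ := Piece.mk_surjective β a
    rw [← map_zero (Piece.mk I α)]
    change Piece.mul _ _ = _
    rw [Piece.mul_mk, ← map_zero (Piece.mk I (α + β))]
    congr 1
    ext
    simp
  mul_add {α β} a c d := by
    obtain ⟨r, rfl⟩ := Piece.mk_surjective α a
    obtain ⟨s, rfl⟩ := Piece.mk_surjective β c
    obtain ⟨t, rfl⟩ := Piece.mk_surjective β d
    change Piece.mul _ _ = Piece.mul _ _ + Piece.mul _ _
    rw [← map_add, Piece.mul_mk, Piece.mul_mk, Piece.mul_mk, ← map_add]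
    congr 1
    ext
    simp [mul_add]
  add_mul {α β} a c d := by
    obtain ⟨r, rfl⟩ := Piece.mk_surjective α a
    obtain ⟨s, rfl⟩ := Piece.mk_surjective α c
    obtain ⟨t, rfl⟩ := Piece.mk_surjective β d
    change Piece.mul _ _ = Piece.mul _ _ + Piece.mul _ _
    rw [← map_add, Piece.mul_mk, Piece.mul_mk, Piece.mul_mk, ← map_add]
    congr 1
    ext
    simp [add_mul]
  one_mul := by
    rintro ⟨α, a⟩
    obtain ⟨r, rfl⟩ := Piece.mk_surjective α a
    exact Piece.sigma_eq (zero_add α) (one_mul _)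
  mul_one := by
    rintro ⟨α, a⟩
    obtain ⟨r, rfl⟩ := Piece.mk_surjective α a
    exact Piece.sigma_eq (add_zero α) (mul_one _)
  mul_assoc := by
    rintro ⟨α, a⟩ ⟨β, c⟩ ⟨γ, d⟩
    obtain ⟨r, rfl⟩ := Piece.mk_surjective α a
    obtain ⟨s, rfl⟩ := Piece.mk_surjective β c
    obtain ⟨t, rfl⟩ := Piece.mk_surjective γ d
    exact Piece.sigma_eq (add_assoc α β γ) (mul_assoc _ _ _)
  mul_comm := by
    rintro ⟨α, a⟩ ⟨β, c⟩
    obtain ⟨r, rfl⟩ := Piece.mk_surjective α a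
    obtain ⟨s, rfl⟩ := Piece.mk_surjective β c
    exact Piece.sigma_eq (add_comm α β) (mul_comm _ _)
  natCast n := Piece.mk I 0 ⟨n, mem_filtGE_zero _⟩
  natCast_zero := by
    rw [← map_zero (Piece.mk I 0)]
    congr 1
    ext
    simp
  natCast_succ n := by
    change _ = _ + Piece.mk I 0 ⟨1, mem_filtGE_zero 1⟩
    rw [← map_add]
    congr 1
    ext
    simp
  intCast n := Piece.mk I 0 ⟨n, mem_filtGE_zero _⟩
  intCast_ofNat n := by
    congr 1
    ext
    simp
  intCast_negSucc_ofNat n := by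
    rw [← map_neg]
    congr 1
    ext
    simp

variable (I)

/-- The balanced associated graded ring `⨁ α, {r : q̄(r) ≥ α} / {r : q̄(r) > α}`.  As `q̄ ≥ 0`,
the pieces of negative degree vanish, so the sum is over the nonnegative rationals. -/
def Ogr : Type _ := ⨁ α : ℚ≥0, Piece I α

noncomputable instance Ogr.instCommRing : CommRing (Ogr I) :=
  inferInstanceAs (CommRing (⨁ α : ℚ≥0, Piece I α))

/-- The inclusion of the piece of degree `α`. -/
noncomputable def Ogr.of (α : ℚ≥0) : Piece I α →+ Ogr I := DirectSum.of (Piece I) α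

/-- The homogeneous elements of degree `α`. -/
noncomputable def Ogr.grade (α : ℚ≥0) : AddSubgroup (Ogr I) := (Ogr.of I α).range

variable {I}

theorem Ogr.one_def : (1 : Ogr I) = Ogr.of I 0 (Piece.mk I 0 ⟨1, mem_filtGE_zero 1⟩) := rfl

theorem Ogr.of_mul_of {α β : ℚ≥0} (r : filtGE I α) (s : filtGE I β) :
    Ogr.of I α (Piece.mk I α r) * Ogr.of I β (Piece.mk I β s) =
      Ogr.of I (α + β) (Piece.mk I (α + β) ⟨(r : R) * s, filtGE_mul_mem r.2 s.2⟩) :=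
  DirectSum.of_mul_of (A := Piece I) _ _

/-- The map in degree `α` induced by a ring homomorphism that takes `I` into `J`. -/
noncomputable def Piece.map {S : Type*} [CommRing S] {J : Ideal S} (f : R →+* S) (hf : I.map f ≤ J)
    (α : ℚ≥0) : Piece I α →+ Piece J α :=
  QuotientAddGroup.map _ _
    (AddMonoidHom.mk' (fun r : filtGE I α => (⟨f r, le_trans r.2 (qbar_le_map f hf r)⟩ : filtGE J α))
      (fun r s => Subtype.ext (map_add f (r : R) s)))
    (fun r hr => lt_of_lt_of_le (show _ < qbar I (r : R) from hr) (qbar_le_map f hf r))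

theorem Piece.map_mk {S : Type*} [CommRing S] {J : Ideal S} (f : R →+* S) (hf : I.map f ≤ J)
    (α : ℚ≥0) (r : filtGE I α) : Piece.map f hf α (Piece.mk I α r) =
      Piece.mk J α ⟨f r, le_trans r.2 (qbar_le_map f hf r)⟩ := rfl

/-- Functoriality of the balanced associated graded ring. -/
noncomputable def Ogr.map {S : Type*} [CommRing S] {J : Ideal S} (f : R →+* S)
    (hf : I.map f ≤ J) : Ogr I →+* Ogr J :=
  DirectSum.toSemiring (A := Piece I) (fun α => (Ogr.of J α).comp (Piece.map f hf α))
    (by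
      refine DirectSum.of_eq_of_gradedMonoid_eq (A := Piece J) (i := 0) (j := 0) ?_
      exact Piece.sigma_eq rfl (map_one f))
    (by
      intro α β a c
      obtain ⟨r, rfl⟩ := Piece.mk_surjective α a
      obtain ⟨s, rfl⟩ := Piece.mk_surjective β c
      simp only [AddMonoidHom.comp_apply, Piece.map_mk, Ogr.of_mul_of]
      refine DirectSum.of_eq_of_gradedMonoid_eq (A := Piece J) (i := α + β) (j := α + β) ?_
      exact Piece.sigma_eq rfl (map_mul f _ _))

theorem Ogr.map_of {S : Type*} [CommRing S] {J : Ideal S} (f : R →+* S) (hf : I.map f ≤ J)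
    (α : ℚ≥0) (r : filtGE I α) : Ogr.map f hf (Ogr.of I α (Piece.mk I α r)) =
      Ogr.of J α (Piece.mk J α ⟨f r, le_trans r.2 (qbar_le_map f hf r)⟩) :=
  DirectSum.toSemiring_of (A := Piece I) _ _ _ α (Piece.mk I α r)

/-- The element of degree one of the balanced associated graded ring of `(R, ⟨b⟩)` that `b`
represents. -/
noncomputable def Ogr.initial (b : R) : Ogr (Ideal.span {b}) :=
  Ogr.of (Ideal.span {b}) 1 (Piece.mk _ 1 ⟨b, by
    change (((1 : ℚ≥0) : ℝ≥0) : ℝ≥0∞) ≤ qbar (Ideal.span {b}) b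
    simpa using one_le_qbar (Ideal.mem_span_singleton_self b)⟩)

end Ogr

section IntegralClosure

variable {A : Type*} [CommRing A] (b : A)

/-- The annihilator ideal of the element `b`. -/
abbrev ann : Ideal A := (Ideal.span {b}).annihilator

/-- The natural map `A / ann(b) → A[b⁻¹]`. -/
noncomputable def quotToAway : A ⧸ ann b →+* Localization.Away b :=
  Ideal.Quotient.lift (ann b) (algebraMap A (Localization.Away b)) (by
    intro a ha
    have h : a * b = 0 := (Submodule.mem_annihilator_span_singleton b a).mp ha
    have h2 : algebraMap A (Localization.Away b) a * algebraMap A (Localization.Away b) b = 0 := by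
      rw [← map_mul, h, map_zero]
    exact (IsLocalization.Away.algebraMap_isUnit (S := Localization.Away b) b).mul_left_eq_zero.mp
      h2)

/-- The integral closure of `A / ann(b)` in `A[b⁻¹]`. -/
noncomputable def ICAway : Subring (Localization.Away b) :=
  letI : Algebra (A ⧸ ann b) (Localization.Away b) := (quotToAway b).toAlgebra
  (integralClosure (A ⧸ ann b) (Localization.Away b)).toSubring

theorem mem_ICAway {x : Localization.Away b} :
    x ∈ ICAway b ↔ (quotToAway b).IsIntegralElem x := Iff.rfl

/-- The natural map from `A` to the integral closure of `A / ann(b)` in `A[b⁻¹]`. -/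
noncomputable def toICAway : A →+* ICAway b :=
  (algebraMap A (Localization.Away b)).codRestrict (ICAway b) fun a =>
    (quotToAway b).isIntegralElem_map (x := Ideal.Quotient.mk (ann b) a)

theorem map_span_le_toICAway :
    (Ideal.span {b}).map (toICAway b) ≤ Ideal.span {toICAway b b} := by
  rw [Ideal.map_span, Set.image_singleton]

/-- The localization `(ogr A)[b⁻¹]` of the balanced associated graded ring of `(A, ⟨b⟩)` at the
degree one element that `b` represents. -/
abbrev OgrAway : Type _ := Localization.Away (Ogr.initial b)

/-- The localization map `ogr A → (ogr A)[b⁻¹]`. -/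
noncomputable abbrev ogrToAway : Ogr (Ideal.span {b}) →+* OgrAway b :=
  algebraMap (Ogr (Ideal.span {b})) (OgrAway b)

/-- The homogeneous elements of degree `α` of `(ogr A)[b⁻¹]`: the fractions `y / b ^ k` with `y`
homogeneous of degree `α + k`. -/
def awayGrade (α : ℚ≥0) : Set (OgrAway b) :=
  {z | ∃ (k : ℕ) (y : Ogr (Ideal.span {b})), y ∈ Ogr.grade (Ideal.span {b}) (α + k) ∧
    z * ogrToAway b (Ogr.initial b) ^ k = ogrToAway b y}

end IntegralClosure

end BalancedGr

/-!
Write `S` for the integral closure of `A / ann(b)` in `A[b⁻¹]`, `gr A` and `gr S` for the balanced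
associated graded rings, and `b` also for the initial form of `b`. Since `b` is invertible in
`A[b⁻¹]`, it is a nonzerodivisor of `S`, and `q̄(b s) = 1 + q̄(s)` there.

The first point is that `gr S` embeds into `(gr A)[b⁻¹]`. Integral elements of `A[b⁻¹]` have powers with
bounded denominators, and the `b`-power torsion of the Noetherian ring `A` is killed by a single
`b ^ K`, so that `K + q̄(s) ≤ q̄(b ^ K r)` whenever `r` has image `s` in `S`
(`exists_forall_add_qbar_le`). Hence `gr A → gr S` becomes an isomorphism once `b` is inverted, and
as `b` is a nonzerodivisor of `gr S`, there is an embedding `gr S → (gr A)[b⁻¹]` over `gr A`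
(`exists_lift_away`). It remains to see that its image is the integral closure.

Both inclusions rest on `exists_eq_toICAway_pow_mul`: if `s ∈ S` has `q̄(s) ≥ k` then `b ^ k` divides
`s` in `S`. The hypothesis says that `x = s / b ^ k` is almost integral, with denominators of powers
`x ^ n` growing slower than any multiple of `n`. Suppose that `x` is not integral. Then, after
inverting `x`, the element `y = x⁻¹` is not a unit of the Noetherian ring `A[y]`, and `b ^ c` is
divisible by `y ^ n` with `c / n` arbitrarily small. A prime `P` minimal over `y` has height at most
one by Krull's theorem, and the nonzerodivisor `b` lies in no minimal prime, so locally at `P` some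
power of `y` is divisible by `b`; then `b ^ c` is divisible by `b ^ (c + 1)`, which is absurd as
`b ∈ P` (`isUnit_of_forall_exists_pow_dvd_pow`).

*`gr S` is integral over `gr A`* (`Ogr.map_toICAway_isIntegral`): if `s` represents a class of degree
`p / m`, then `s ^ m = b ^ p t` with `t ∈ S`, and the class of `t` in degree zero inherits an integral
equation from `t`.

*`gr S` is integrally closed in `(gr S)[b⁻¹]`* (`Ogr.mem_range_of_isIntegral`): let `h / b ^ n` be
integral. Clearing denominators gives a monic equation for `h`, and if `h` had a component of degree
below `n`, a power of its lowest form would vanish (`Ogr.mem_supported_Ici_of_monic`); but `gr S` has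
no nonzero nilpotent homogeneous elements because `q̄(r ^ N) = N q̄(r)`. So `h` lives in degrees at least `n`,
where every element is divisible by `b ^ n`.
-/

namespace BalancedGr

open Filter Topology Polynomial
open scoped NNReal ENNReal DirectSum

/-! ### Elements that are integral up to small denominators -/

/-- An element `y` of a Noetherian ring is a unit if arbitrarily high powers of it divide
comparatively low powers of a nonzerodivisor `b`: at a prime of height one over `y`, the element `b`
would be divisible by too high a power of itself. -/
theorem isUnit_of_forall_exists_pow_dvd_pow {A : Type*} [CommRing A] [IsNoetherianRing A] {b y : A}
    (hb : b ∈ nonZeroDivisors A)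
    (h : ∀ f : ℕ, ∃ n c : ℕ, f * (c + 1) ≤ n ∧ y ^ n ∣ b ^ c) : IsUnit y := by
  by_contra hy
  obtain ⟨M, hM, hyM⟩ := exists_max_ideal_of_mem_nonunits hy
  obtain ⟨P, hP, -⟩ := Ideal.exists_minimalPrimes_le (I := Ideal.span {y}) (J := M)
    ((Ideal.span_singleton_le_iff_mem _).mpr hyM)
  have hPprime : P.IsPrime := hP.isPrime
  have hyP : y ∈ P := (Ideal.span_singleton_le_iff_mem _).mp hP.le
  have hht : P.height ≤ 1 := Ideal.height_le_one_of_isPrincipal_of_mem_minimalPrimes _ P hP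
  -- As `P` has height at most one and `b` lies in no minimal prime, a power of `y` lies in `(b)`
  -- locally at `P`.
  have hloc : ∃ (f : ℕ) (u : A), u ∉ P ∧ b ∣ u * y ^ f := by
    by_contra! hcon
    let T : Submonoid A := P.primeCompl ⊔ Submonoid.powers y
    have hdis : Disjoint (Ideal.span {b} : Set A) T := by
      rw [Set.disjoint_left]
      intro a ha haT
      obtain ⟨u, hu, w, ⟨f, rfl⟩, rfl⟩ := Submonoid.mem_sup.mp haT
      exact hcon f u hu (Ideal.mem_span_singleton.mp ha)
    obtain ⟨Q, hQ, hbQ, hQT⟩ := Ideal.exists_le_prime_disjoint _ T hdis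
    have hyQ : y ∉ Q := fun hyQ => Set.disjoint_left.mp hQT hyQ
      ((le_sup_right : _ ≤ T) (Submonoid.mem_powers y))
    have hQP : Q ≤ P := fun a ha => by
      by_contra haP
      exact Set.disjoint_left.mp hQT ha ((le_sup_left : _ ≤ T) haP)
    have hlt : Q < P := lt_of_le_of_ne hQP fun h => hyQ (h ▸ hyP)
    have h1 := Ideal.height_strict_mono_of_isPrime_of_isPrime hlt
    have h2 : Q.height = 0 := by
      have := h1.trans_le hht
      exact Order.lt_one_iff.mp this
    have h3 : Q ∈ minimalPrimes A := Ideal.height_eq_zero_iff.mp h2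
    exact Set.disjoint_left.mp (Ideal.disjoint_nonZeroDivisors_of_mem_minimalPrimes h3)
      (hbQ (Ideal.mem_span_singleton_self b)) hb
  obtain ⟨f, u, huP, a, ha⟩ := hloc
  obtain ⟨n, c, hn, d, hd⟩ := h (f + 1)
  have hbP : b ∈ P := by
    refine hPprime.mem_of_pow_mem c ?_
    rw [hd]
    exact P.mul_mem_right _ (P.pow_mem_of_mem hyP _ (by nlinarith))
  obtain ⟨e, rfl⟩ := Nat.exists_eq_add_of_le (show f * (c + 1) ≤ n by nlinarith)
  have key : u ^ (c + 1) = b * (a ^ (c + 1) * y ^ e * d) := by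
    refine (mul_cancel_left_mem_nonZeroDivisors (pow_mem hb c)).mp ?_
    calc b ^ c * u ^ (c + 1) = (u * y ^ f) ^ (c + 1) * y ^ e * d := by
          rw [hd]; ring
      _ = _ := by rw [ha]; ring
  exact huP (hPprime.mem_of_pow_mem (c + 1) (key ▸ P.mul_mem_right _ hbP))

/-- If the inverse of `y` is a polynomial `p` in `y`, reversing `1 - X * p` gives an integral
equation for it. -/
theorem isIntegral_of_mul_eq_one_of_mem_adjoin {R L : Type*} [CommRing R] [CommRing L]
    [Algebra R L] {x y : L} (hxy : x * y = 1) (hx : x ∈ Algebra.adjoin R {y}) :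
    IsIntegral R x := by
  nontriviality R
  rw [Algebra.adjoin_singleton_eq_range_aeval] at hx
  obtain ⟨p, hp : aeval y p = x⟩ := hx
  set q : R[X] := 1 - X * p with hq
  have h0 : q.coeff 0 = 1 := by simp [hq]
  have hlead : q.reverse.Monic := by
    rw [Monic, reverse_leadingCoeff, trailingCoeff,
      natTrailingDegree_eq_zero.mpr (Or.inr (by simp [h0])), h0]
  refine ⟨q.reverse, hlead, ?_⟩
  let : Invertible y := ⟨x, hxy, by rw [mul_comm, hxy]⟩
  have hinv : ⅟y = x := rfl
  rw [← hinv, eval₂_reverse_eq_zero_iff, ← aeval_def, hq]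
  simp only [map_sub, map_one, map_mul, aeval_X]
  rw [hp, mul_comm, hxy, sub_self]

theorem isIntegral_of_isUnit_of_almost {R L : Type*} [CommRing R] [IsNoetherianRing R]
    [CommRing L] [Algebra R L] {b : R} (hb : IsUnit (algebraMap R L b)) {x : L} (hxu : IsUnit x)
    (hx : ∀ f : ℕ, ∃ (n c : ℕ) (a : R), f * (c + 1) ≤ n ∧
      x ^ n * algebraMap R L b ^ c = algebraMap R L a) : IsIntegral R x := by
  obtain ⟨y, hxy⟩ := hxu.exists_right_inv
  set A := Algebra.adjoin R {y}
  have : IsNoetherianRing A := by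
    have := Algebra.FiniteType.adjoin_of_finite (R := R) (Set.finite_singleton y)
    exact Algebra.FiniteType.isNoetherianRing R A
  set y' : A := ⟨y, Algebra.subset_adjoin rfl⟩
  have hbA : algebraMap R A b ∈ nonZeroDivisors A := by
    rw [mem_nonZeroDivisors_iff_right]
    intro z hz
    have h1 : (z : L) * algebraMap R L b = 0 := congrArg Subtype.val hz
    exact Subtype.ext (hb.mul_left_eq_zero.mp h1)
  have hu : IsUnit y' := by
    refine isUnit_of_forall_exists_pow_dvd_pow hbA fun f => ?_
    obtain ⟨n, c, a, hn, h⟩ := hx f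
    refine ⟨n, c, hn, algebraMap R A a, Subtype.ext ?_⟩
    change algebraMap R L b ^ c = y ^ n * algebraMap R L a
    rw [← h, ← mul_assoc, ← mul_pow, mul_comm y, hxy, one_pow, one_mul]
  obtain ⟨x', hx'⟩ := hu.exists_right_inv
  have h1 : y * (x' : L) = 1 := congrArg Subtype.val hx'
  have h2 : x = x' := by
    calc x = x * (y * x') := by rw [h1, mul_one]
      _ = x' := by rw [← mul_assoc, hxy, one_mul]
  exact isIntegral_of_mul_eq_one_of_mem_adjoin hxy (h2 ▸ x'.2)

/-- An element some powers `x ^ n` of which have denominators `b ^ c` with `c / n` arbitrarily small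
is integral over a Noetherian ring. -/
theorem isIntegral_of_almost {R L : Type*} [CommRing R] [IsNoetherianRing R]
    [CommRing L] [Algebra R L] {b : R} (hb : IsUnit (algebraMap R L b)) {x : L}
    (hx : ∀ f : ℕ, ∃ (n c : ℕ) (a : R), f * (c + 1) ≤ n ∧
      x ^ n * algebraMap R L b ^ c = algebraMap R L a) : IsIntegral R x := by
  -- Integrality may be tested after inverting `x`: a power of `x` kills the value of a monic
  -- polynomial that vanishes there.
  have hint : IsIntegral R (algebraMap L (Localization.Away x) x) := by
    refine isIntegral_of_isUnit_of_almost (b := b) ?_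
      (IsLocalization.Away.algebraMap_isUnit x) fun f => ?_
    · rw [IsScalarTower.algebraMap_apply R L]
      exact hb.map _
    · obtain ⟨n, c, a, hn, h⟩ := hx f
      refine ⟨n, c, a, hn, ?_⟩
      rw [IsScalarTower.algebraMap_apply R L, ← map_pow, ← map_pow, ← map_mul, h,
        ← IsScalarTower.algebraMap_apply R L]
  obtain ⟨p, hp, hpx⟩ := hint
  rw [← aeval_def, aeval_algebraMap_apply] at hpx
  obtain ⟨⟨_, j, rfl⟩, hj⟩ :=
    (IsLocalization.map_eq_zero_iff (Submonoid.powers x) (Localization.Away x) _).mp hpx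
  refine ⟨X ^ j * p, (monic_X_pow j).mul hp, ?_⟩
  rw [← aeval_def]
  simpa using hj

/-! ### The order `q̄` and the integral closure in the localization -/

section
variable {R : Type*} [CommRing R] {I : Ideal R}

theorem mem_span_singleton_pow {b r : R} {p : ℕ} : r ∈ Ideal.span {b} ^ p ↔ b ^ p ∣ r := by
  rw [Ideal.span_singleton_pow, Ideal.mem_span_singleton]

theorem qbar_pow (r : R) {N : ℕ} (hN : N ≠ 0) : qbar I (r ^ N) = N * qbar I r := by
  have h1 : Tendsto (fun n : ℕ => N * n) atTop atTop :=
    tendsto_id.const_mul_atTop' (Nat.pos_of_ne_zero hN)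
  have h2 := ENNReal.Tendsto.const_mul ((tendsto_qbar I r).comp h1) (a := (N : ℝ≥0∞))
    (Or.inr (ENNReal.natCast_ne_top N))
  refine tendsto_nhds_unique (tendsto_qbar I (r ^ N)) (h2.congr fun n => ?_)
  have hN' : (N : ℝ≥0∞) ≠ 0 := by exact_mod_cast hN
  simp only [Function.comp_apply, ← pow_mul]
  push_cast
  rw [← mul_div_assoc, ENNReal.mul_div_mul_left _ _ hN' (ENNReal.natCast_ne_top N)]

/-- A bounded defect `D` in the exponents does not affect `q̄`. -/
theorem div_le_qbar_of_eventually {r : R} {m q D : ℕ} (hm : 0 < m)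
    (h : ∀ᶠ n : ℕ in atTop, r ^ (m * n) ∈ I ^ (q * n - D)) : (q : ℝ≥0∞) / m ≤ qbar I r := by
  have hlim : Tendsto (fun n : ℕ => ((q : ℝ≥0∞) - D / n) / m) atTop
      (𝓝 (((q : ℝ≥0∞) - 0) / m)) := by
    refine ENNReal.Tendsto.div_const ?_ (Or.inr (by exact_mod_cast hm.ne'))
    refine ENNReal.Tendsto.sub tendsto_const_nhds ?_ (Or.inl (ENNReal.natCast_ne_top q))
    have := ENNReal.Tendsto.const_div (a := (D : ℝ≥0∞)) ENNReal.tendsto_nat_nhds_top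
      (Or.inr (ENNReal.natCast_ne_top D))
    simpa using this
  rw [tsub_zero] at hlim
  refine le_of_tendsto hlim ?_
  filter_upwards [h, eventually_gt_atTop 0] with n hn hn0
  refine le_trans (le_of_eq ?_) (div_le_qbar (Nat.mul_pos hm hn0) hn)
  have hn0' : (n : ℝ≥0∞) ≠ 0 := by exact_mod_cast hn0.ne'
  have hnt : (n : ℝ≥0∞) ≠ ⊤ := ENNReal.natCast_ne_top n
  rw [ENNReal.natCast_sub, ← ENNReal.mul_div_mul_right _ (m : ℝ≥0∞) hn0' hnt,
    ENNReal.sub_mul fun _ _ => hnt, ENNReal.div_mul_cancel hn0' hnt]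
  push_cast
  rfl

end

section
variable {A : Type*} [CommRing A] (b : A)

theorem isIntegralElem_comp_iff_of_surjective {A B C : Type*} [CommRing A] [CommRing B]
    [CommRing C] {π : A →+* B} (hπ : Function.Surjective π) (f : B →+* C) {x : C} :
    (f.comp π).IsIntegralElem x ↔ f.IsIntegralElem x := by
  refine ⟨RingHom.isIntegralElem.of_comp π f, ?_⟩
  rintro ⟨p, hp, hx⟩
  rcases subsingleton_or_nontrivial C with hC | hC
  · exact ⟨1, monic_one, Subsingleton.elim _ _⟩
  have : Nontrivial B := f.domain_nontrivial
  obtain ⟨q, hq, -, hqm⟩ := lifts_and_natDegree_eq_and_monic (mem_lifts_of_surjective hπ p) hp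
  refine ⟨q, hqm, ?_⟩
  rw [← eval₂_map, hq, hx]

theorem isIntegralElem_quotToAway_iff {x : Localization.Away b} :
    (quotToAway b).IsIntegralElem x ↔ IsIntegral A x := by
  rw [← isIntegralElem_comp_iff_of_surjective (Ideal.Quotient.mk_surjective (I := ann b)),
    quotToAway, Ideal.Quotient.lift_comp_mk]
  rfl

theorem mem_ICAway_iff_isIntegral {x : Localization.Away b} : x ∈ ICAway b ↔ IsIntegral A x :=
  (mem_ICAway b).trans (isIntegralElem_quotToAway_iff b)

theorem isUnit_algebraMap_away : IsUnit (algebraMap A (Localization.Away b) b) :=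
  IsLocalization.Away.algebraMap_isUnit b

theorem toICAway_mul_left_cancel {s t : ICAway b} (n : ℕ)
    (h : toICAway b b ^ n * s = toICAway b b ^ n * t) : s = t := by
  refine Subtype.ext (((isUnit_algebraMap_away b).pow n).mul_left_cancel ?_)
  exact congrArg Subtype.val h

/-- The powers of an element integral over `A` have bounded denominators. -/
theorem exists_forall_pow_mul_eq_algebraMap {t : Localization.Away b} (ht : IsIntegral A t) :
    ∃ D : ℕ, ∀ n : ℕ, ∃ a : A,
      t ^ n * algebraMap A (Localization.Away b) b ^ D = algebraMap A (Localization.Away b) a := by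
  obtain ⟨s, hs⟩ := ht.fg_adjoin_singleton
  obtain ⟨c, hD⟩ := IsLocalization.exist_integer_multiples_of_finset (Submonoid.powers b) s
  obtain ⟨D, hc⟩ := c.2
  refine ⟨D, fun n => ?_⟩
  have hle : Subalgebra.toSubmodule (Algebra.adjoin A {t}) ≤
      (LinearMap.range (Algebra.linearMap A (Localization.Away b))).comap
        (LinearMap.lsmul A (Localization.Away b) (c : A)) := by
    rw [← hs, Submodule.span_le]
    intro x hx
    obtain ⟨a, ha⟩ := hD x hx
    exact ⟨a, ha⟩
  have hmem : t ^ n ∈ Subalgebra.toSubmodule (Algebra.adjoin A {t}) :=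
    pow_mem (Algebra.subset_adjoin rfl : t ∈ Algebra.adjoin A {t}) n
  obtain ⟨a, ha⟩ := Submodule.mem_comap.mp (hle hmem)
  refine ⟨a, ?_⟩
  rw [Algebra.linearMap_apply, LinearMap.lsmul_apply, Algebra.smul_def, ← hc, map_pow] at ha
  rw [ha, mul_comm]

theorem exists_pow_mul_eq_toICAway (s : ICAway b) :
    ∃ (j : ℕ) (r : A), toICAway b b ^ j * s = toICAway b r := by
  obtain ⟨j, r, h⟩ := IsLocalization.Away.surj b (s : Localization.Away b)
  exact ⟨j, r, Subtype.ext ((mul_comm _ _).trans h)⟩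

/-- Multiplication by `b` raises the order in the integral closure by exactly one, as `b` may be
cancelled there. -/
theorem qbar_toICAway_mul (s : ICAway b) :
    qbar (Ideal.span {toICAway b b}) (toICAway b b * s) =
      1 + qbar (Ideal.span {toICAway b b}) s := by
  refine le_antisymm (le_of_forall_lt fun x hx => ?_)
    ((add_le_add_left (one_le_qbar (Ideal.mem_span_singleton_self _)) _).trans (le_qbar_mul _ _))
  obtain ⟨m, p, hm, hr, hlt⟩ := exists_of_lt_limsup hx
  refine hlt.trans_le ?_
  have hm0 : (m : ℝ≥0∞) ≠ 0 := by exact_mod_cast hm.ne'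
  rcases le_total p m with h | h
  · refine le_trans (ENNReal.div_le_of_le_mul ?_) le_self_add
    rw [one_mul]
    exact_mod_cast h
  · obtain ⟨d, rfl⟩ := Nat.exists_eq_add_of_le h
    obtain ⟨c, hc⟩ := mem_span_singleton_pow.mp hr
    rw [mul_pow, pow_add, mul_assoc] at hc
    have h1 := div_le_qbar hm (mem_span_singleton_pow.mpr ⟨c, toICAway_mul_left_cancel b m hc⟩)
    push_cast
    rw [ENNReal.add_div, ENNReal.div_self hm0 (ENNReal.natCast_ne_top m)]
    exact add_le_add_right h1 _

theorem qbar_toICAway_pow_mul (k : ℕ) (s : ICAway b) :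
    qbar (Ideal.span {toICAway b b}) (toICAway b b ^ k * s) =
      k + qbar (Ideal.span {toICAway b b}) s := by
  induction k with
  | zero => simp
  | succ k ih =>
    rw [pow_succ', mul_assoc, qbar_toICAway_mul, ih]
    push_cast
    ring

variable [IsNoetherianRing A]

/-- A single power of `b` kills the `b`-power torsion. -/
theorem exists_pow_mul_eq_zero :
    ∃ K : ℕ, 0 < K ∧ ∀ a : A, algebraMap A (Localization.Away b) a = 0 → b ^ K * a = 0 := by
  let f : ℕ →o Ideal A :=
    ⟨fun n => LinearMap.ker (LinearMap.lsmul A A (b ^ n)), fun m n hmn a ha => by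
      obtain ⟨d, rfl⟩ := Nat.exists_eq_add_of_le hmn
      have ha' : b ^ m * a = 0 := ha
      change b ^ (m + d) * a = 0
      rw [pow_add, mul_right_comm, ha', zero_mul]⟩
  obtain ⟨K, hK⟩ := monotone_stabilizes_iff_noetherian.mpr ‹IsNoetherianRing A› f
  refine ⟨K + 1, K.succ_pos, fun a ha => ?_⟩
  obtain ⟨⟨_, n, rfl⟩, hn⟩ := (IsLocalization.map_eq_zero_iff (Submonoid.powers b) _ _).mp ha
  have h1 : a ∈ f (n + K) := f.monotone (Nat.le_add_right n K) hn
  rw [← hK (n + K) (Nat.le_add_left K n), hK (K + 1) K.le_succ] at h1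
  exact h1

/-- Up to multiplication by a fixed power of `b`, the order `q̄` of an element of `A` may be
computed in the integral closure. -/
theorem exists_forall_add_qbar_le :
    ∃ K : ℕ, ∀ r : A, K + qbar (Ideal.span {toICAway b b}) (toICAway b r) ≤
      qbar (Ideal.span {b}) (b ^ K * r) := by
  obtain ⟨K, hK0, hK⟩ := exists_pow_mul_eq_zero b
  refine ⟨K, fun r => ?_⟩
  have hle : ∀ x < qbar (Ideal.span {toICAway b b}) (toICAway b r),
      K + x ≤ qbar (Ideal.span {b}) (b ^ K * r) := by
    intro x hx
    obtain ⟨m, p, hm, hr, hlt⟩ := exists_of_lt_limsup hx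
    obtain ⟨t, ht⟩ := mem_span_singleton_pow.mp hr
    have htL : algebraMap A (Localization.Away b) r ^ m =
        algebraMap A (Localization.Away b) b ^ p * t := congrArg Subtype.val ht
    obtain ⟨D, hD⟩ := exists_forall_pow_mul_eq_algebraMap b ((mem_ICAway_iff_isIntegral b).mp t.2)
    have hm0 : (m : ℝ≥0∞) ≠ 0 := by exact_mod_cast hm.ne'
    have hmem : ∀ᶠ n : ℕ in atTop,
        (b ^ K * r) ^ (m * n) ∈ Ideal.span {b} ^ ((K * m + p) * n - D) := by
      filter_upwards [eventually_ge_atTop (D + K)] with n hn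
      obtain ⟨c, hc⟩ := hD n
      have h1 : b ^ K * (b ^ D * r ^ (m * n) - b ^ (p * n) * c) = 0 := by
        refine hK _ ?_
        rw [map_sub, map_mul, map_mul, ← hc, map_pow, map_pow, map_pow, pow_mul, htL]
        ring
      rw [mul_sub, sub_eq_zero] at h1
      have h2 : D + K ≤ K * (m * n) :=
        hn.trans ((Nat.le_mul_of_pos_left n hm).trans (Nat.le_mul_of_pos_left _ hK0))
      obtain ⟨e, he⟩ := Nat.exists_eq_add_of_le h2
      refine mem_span_singleton_pow.mpr ((pow_dvd_pow b (n := e + K + p * n) ?_).trans ⟨c, ?_⟩)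
      · rw [add_mul, mul_assoc, he]
        omega
      · calc (b ^ K * r) ^ (m * n) = b ^ e * (b ^ K * (b ^ D * r ^ (m * n))) := by
              rw [mul_pow, ← pow_mul, he]; ring
          _ = _ := by rw [h1]; ring
    have h3 := div_le_qbar_of_eventually hm hmem
    refine le_trans ?_ h3
    push_cast
    rw [ENNReal.add_div, ENNReal.mul_div_cancel_right hm0 (ENNReal.natCast_ne_top m)]
    exact add_le_add_right hlt.le _
  have hKle : (K : ℝ≥0∞) ≤ qbar (Ideal.span {b}) (b ^ K * r) := by
    refine le_trans (le_trans ?_ le_self_add) (le_qbar_mul _ _)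
    simpa using div_le_qbar (I := Ideal.span {b}) (r := b ^ K) (m := 1) (p := K) one_pos
      (mem_span_singleton_pow.mpr (by simp))
  have h1 : qbar (Ideal.span {toICAway b b}) (toICAway b r) ≤
      qbar (Ideal.span {b}) (b ^ K * r) - K :=
    le_of_forall_lt_imp_le_of_dense fun x hx =>
      ENNReal.le_sub_of_add_le_left (ENNReal.natCast_ne_top K) (hle x hx)
  calc _ ≤ (K : ℝ≥0∞) + (qbar (Ideal.span {b}) (b ^ K * r) - K) := add_le_add_right h1 _
    _ = _ := add_tsub_cancel_of_le hKle

/-- If `q̄(r) ≥ k` then `r / b ^ k` is integral. -/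
theorem isIntegral_of_le_qbar {r : A} {k : ℕ} (hr : (k : ℝ≥0∞) ≤ qbar (Ideal.span {b}) r)
    {z : Localization.Away b}
    (hz : z * algebraMap A (Localization.Away b) b ^ k = algebraMap A (Localization.Away b) r) :
    IsIntegral A z := by
  rcases Nat.eq_zero_or_pos k with rfl | hk
  · rw [pow_zero, mul_one] at hz
    exact hz ▸ isIntegral_algebraMap
  refine isIntegral_of_almost (isUnit_algebraMap_away b) fun f => ?_
  -- Any `p / m` with `k - 1 / (2 f + 1) < p / m` makes `z ^ m` have a denominator `b ^ e` with `e`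
  -- small against `m`; the power `z ^ (m * 2 f)` then satisfies the required inequality.
  have hx : ENNReal.ofReal (k - 1 / (2 * f + 1)) < qbar (Ideal.span {b}) r := by
    refine lt_of_lt_of_le ?_ hr
    rw [← ENNReal.ofReal_natCast k, ENNReal.ofReal_lt_ofReal_iff (by exact_mod_cast hk)]
    have : (0 : ℝ) < 1 / (2 * f + 1) := by positivity
    linarith
  obtain ⟨m, p, hm, hrm, hlt⟩ := exists_of_lt_limsup hx
  obtain ⟨a, ha⟩ := mem_span_singleton_pow.mp hrm
  have he : 2 * f * (k * m - p) ≤ m := by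
    rcases le_total (k * m) p with h | h
    · simp [Nat.sub_eq_zero_of_le h]
    have hm' : (0 : ℝ) < m := by exact_mod_cast hm
    rw [← ENNReal.ofReal_natCast p, ← ENNReal.ofReal_natCast m,
      ← ENNReal.ofReal_div_of_pos hm', ENNReal.ofReal_lt_ofReal_iff_of_nonneg] at hlt
    · rw [lt_div_iff₀ hm', sub_mul, div_mul_eq_mul_div, one_mul, sub_lt_comm,
        lt_div_iff₀ (by positivity)] at hlt
      have h3 : ((2 * f * (k * m - p) : ℕ) : ℝ) ≤ m := by
        push_cast [Nat.cast_sub h]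
        have : (0 : ℝ) ≤ k * m - p := by
          rw [sub_nonneg]; exact_mod_cast h
        nlinarith
      exact_mod_cast h3
    · have h1 : (1 : ℝ) ≤ k := by exact_mod_cast hk
      have h2 : 1 / (2 * (f : ℝ) + 1) ≤ 1 := by
        rw [div_le_one (by positivity)]
        linarith [Nat.cast_nonneg (α := ℝ) f]
      linarith
  -- The truncated difference: `e = 0` if `p` exceeds `k * m`.
  set e := k * m - p
  obtain ⟨d, hd⟩ := Nat.exists_eq_add_of_le (show k * m ≤ p + e by omega)
  have hpow : z ^ m * algebraMap A (Localization.Away b) b ^ e =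
      algebraMap A (Localization.Away b) (b ^ d * a) := by
    refine ((isUnit_algebraMap_away b).pow (k * m)).mul_right_cancel ?_
    calc z ^ m * algebraMap A (Localization.Away b) b ^ e *
          algebraMap A (Localization.Away b) b ^ (k * m)
        = (z * algebraMap A (Localization.Away b) b ^ k) ^ m *
          algebraMap A (Localization.Away b) b ^ e := by ring
      _ = algebraMap A (Localization.Away b) (b ^ (p + e) * a) := by
          rw [hz, ← map_pow, ha, ← map_pow, ← map_mul]
          ring_nf
      _ = _ := by
          rw [hd, pow_add, ← map_pow, ← map_mul]
          ring_nf
  refine ⟨m * (2 * f), e * (2 * f), (b ^ d * a) ^ (2 * f), ?_, ?_⟩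
  · have : 1 ≤ m := hm
    nlinarith
  · rw [pow_mul z, pow_mul (algebraMap A (Localization.Away b) b), ← mul_pow, hpow, map_pow]

/-- In the integral closure an element of order at least `k` is divisible by `b ^ k`. -/
theorem exists_eq_toICAway_pow_mul {s : ICAway b} {k : ℕ}
    (hs : (k : ℝ≥0∞) ≤ qbar (Ideal.span {toICAway b b}) s) :
    ∃ t : ICAway b, s = toICAway b b ^ k * t := by
  obtain ⟨K, hK⟩ := exists_forall_add_qbar_le b
  obtain ⟨j, r, hj⟩ := exists_pow_mul_eq_toICAway b s
  obtain ⟨u, hu⟩ := (isUnit_algebraMap_away b).exists_left_inv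
  have hsu : (s : Localization.Away b) * u ^ k * algebraMap A (Localization.Away b) b ^ k = s := by
    rw [mul_assoc, ← mul_pow, hu, one_pow, mul_one]
  have hint : IsIntegral A ((s : Localization.Away b) * u ^ k) := by
    refine isIntegral_of_le_qbar b (r := b ^ K * r) (k := K + (j + k)) ?_ ?_
    · refine le_trans ?_ (hK r)
      rw [← hj, qbar_toICAway_pow_mul]
      push_cast
      gcongr
    · have hjL : algebraMap A (Localization.Away b) b ^ j * s =
        algebraMap A (Localization.Away b) r := congrArg Subtype.val hj
      rw [map_mul, map_pow, ← hjL, pow_add, pow_add]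
      nth_rewrite 2 [← hsu]
      ring
  refine ⟨⟨_, (mem_ICAway_iff_isIntegral b).mpr hint⟩, Subtype.ext ?_⟩
  exact hsu.symm.trans (mul_comm _ _)

end

/-! ### Degrees and lowest forms in the balanced associated graded ring -/

section
variable {R : Type*} [CommRing R] {I : Ideal R}

theorem mem_filtGE {α : ℚ≥0} {r : R} : r ∈ filtGE I α ↔ ((α : ℝ≥0) : ℝ≥0∞) ≤ qbar I r := Iff.rfl

theorem mem_filtGT {α : ℚ≥0} {r : R} : r ∈ filtGT I α ↔ ((α : ℝ≥0) : ℝ≥0∞) < qbar I r := Iff.rfl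

theorem pow_mem_filtGE {α : ℚ≥0} {r : R} (hr : r ∈ filtGE I α) (n : ℕ) :
    r ^ n ∈ filtGE I (n * α) := by
  rcases eq_or_ne n 0 with rfl | hn
  · rw [Nat.cast_zero, zero_mul]
    exact mem_filtGE_zero _
  · rw [mem_filtGE, qbar_pow r hn]
    push_cast
    gcongr
    exact hr

theorem mem_filtGT_of_pow_mem {α : ℚ≥0} {r : R} {n : ℕ} (hn : n ≠ 0)
    (hr : r ^ n ∈ filtGT I (n * α)) : r ∈ filtGT I α := by
  rw [mem_filtGT, qbar_pow r hn] at hr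
  push_cast at hr
  exact lt_of_mul_lt_mul_left' hr

/-- The class in degree `α` of an element `r` with `q̄(r) ≥ α`, as a homogeneous element of the
balanced associated graded ring. -/
noncomputable def Ogr.cls (α : ℚ≥0) (r : R) (hr : r ∈ filtGE I α) : Ogr I :=
  Ogr.of I α (Piece.mk I α ⟨r, hr⟩)

theorem Ogr.cls_congr {α β : ℚ≥0} {r s : R} (hαβ : α = β) (hrs : r = s) (hr : r ∈ filtGE I α)
    (hs : s ∈ filtGE I β) : Ogr.cls α r hr = Ogr.cls β s hs := by
  subst hαβ hrs
  rfl

theorem Ogr.cls_mul_cls {α β : ℚ≥0} {r s : R} (hr : r ∈ filtGE I α) (hs : s ∈ filtGE I β) :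
    Ogr.cls α r hr * Ogr.cls β s hs = Ogr.cls (α + β) (r * s) (filtGE_mul_mem hr hs) :=
  Ogr.of_mul_of _ _

theorem Ogr.cls_pow {α : ℚ≥0} {r : R} (hr : r ∈ filtGE I α) (n : ℕ) :
    Ogr.cls α r hr ^ n = Ogr.cls (n * α) (r ^ n) (pow_mem_filtGE hr n) := by
  induction n with
  | zero =>
    rw [pow_zero, Ogr.one_def]
    exact Ogr.cls_congr (by simp) (pow_zero r).symm (mem_filtGE_zero 1) _
  | succ n ih =>
    rw [pow_succ, ih, Ogr.cls_mul_cls]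
    exact Ogr.cls_congr (by push_cast; ring) (pow_succ r n).symm _ _

theorem Ogr.cls_add {α : ℚ≥0} {r s : R} (hr : r ∈ filtGE I α) (hs : s ∈ filtGE I α) :
    Ogr.cls α r hr + Ogr.cls α s hs = Ogr.cls α (r + s) (add_mem hr hs) :=
  (map_add ((Ogr.of I α).comp (Piece.mk I α).toAddMonoidHom) ⟨r, hr⟩ ⟨s, hs⟩).symm

theorem Ogr.exists_of_eq_cls {α : ℚ≥0} (p : Piece I α) :
    ∃ (r : R) (hr : r ∈ filtGE I α), Ogr.of I α p = Ogr.cls α r hr := by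
  obtain ⟨⟨r, hr⟩, rfl⟩ := Piece.mk_surjective α p
  exact ⟨r, hr, rfl⟩

theorem Piece.mk_eq_zero_iff {α : ℚ≥0} {r : filtGE I α} :
    Piece.mk I α r = 0 ↔ (r : R) ∈ filtGT I α := by
  rw [← map_zero (Piece.mk I α), Piece.mk_eq_mk]
  simp

/-- The component of degree `α`. -/
noncomputable def Ogr.component (α : ℚ≥0) : Ogr I →+ Piece I α :=
  DFinsupp.evalAddMonoidHom (β := Piece I) α

theorem Ogr.component_of (α : ℚ≥0) (p : Piece I α) : Ogr.component α (Ogr.of I α p) = p :=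
  DirectSum.of_eq_same (β := Piece I) α p

theorem Ogr.component_of_ne {α β : ℚ≥0} (h : α ≠ β) (p : Piece I α) :
    Ogr.component β (Ogr.of I α p) = 0 :=
  DirectSum.of_eq_of_ne (β := Piece I) α β p h.symm

theorem Ogr.finite_support (x : Ogr I) : {α | Ogr.component α x ≠ 0}.Finite :=
  DFinsupp.finite_support (β := Piece I) x

theorem Ogr.mem_of_forall_of_component_mem {x : Ogr I} {M : AddSubgroup (Ogr I)}
    (h : ∀ α, Ogr.of I α (Ogr.component α x) ∈ M) : x ∈ M := by
  classical
  have hx : ∑ α ∈ DFinsupp.support (β := Piece I) x, Ogr.of I α (Ogr.component α x) = x :=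
    DirectSum.sum_support_of (β := Piece I) x
  rw [← hx]
  exact sum_mem fun α _ => h α

theorem Ogr.cls_eq_zero_iff {α : ℚ≥0} {r : R} (hr : r ∈ filtGE I α) :
    Ogr.cls α r hr = 0 ↔ r ∈ filtGT I α := by
  rw [← Piece.mk_eq_zero_iff (r := ⟨r, hr⟩), Ogr.cls]
  constructor
  · intro h
    rw [← Ogr.component_of (I := I) α (Piece.mk I α ⟨r, hr⟩), h, map_zero]
  · intro h
    rw [h, map_zero]

variable (I) in
/-- The elements of the balanced associated graded ring all of whose nonzero components have
degree in `U`. -/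
noncomputable def Ogr.supported (U : Set ℚ≥0) : AddSubgroup (Ogr I) where
  carrier := {x | ∀ α ∉ U, Ogr.component α x = 0}
  add_mem' {x y} hx hy α hα := by rw [map_add, hx α hα, hy α hα, add_zero]
  zero_mem' α _ := map_zero _
  neg_mem' {x} hx α hα := by rw [map_neg, hx α hα, neg_zero]

theorem Ogr.of_mem_supported {U : Set ℚ≥0} {α : ℚ≥0} (hα : α ∈ U) (p : Piece I α) :
    Ogr.of I α p ∈ Ogr.supported I U := fun β hβ =>
  Ogr.component_of_ne (fun h : α = β => hβ (h ▸ hα)) p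

theorem Ogr.cls_mem_supported {U : Set ℚ≥0} {α : ℚ≥0} (hα : α ∈ U) {r : R}
    (hr : r ∈ filtGE I α) : Ogr.cls α r hr ∈ Ogr.supported I U :=
  Ogr.of_mem_supported hα _

theorem Ogr.supported_le {U : Set ℚ≥0} {M : AddSubgroup (Ogr I)}
    (h : ∀ α ∈ U, ∀ (r : R) (hr : r ∈ filtGE I α), Ogr.cls α r hr ∈ M) :
    Ogr.supported I U ≤ M := by
  intro x hx
  refine Ogr.mem_of_forall_of_component_mem fun α => ?_
  by_cases hα : α ∈ U
  · obtain ⟨r, hr, heq⟩ := Ogr.exists_of_eq_cls (Ogr.component α x)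
    rw [heq]
    exact h α hα r hr
  · rw [hx α hα, map_zero]
    exact zero_mem _

theorem Ogr.mem_supported_Ici_zero (x : Ogr I) : x ∈ Ogr.supported I (Set.Ici 0) :=
  fun _ hα => absurd (Set.mem_Ici.mpr zero_le) hα

theorem Ogr.mem_of_forall_cls_mem {M : AddSubgroup (Ogr I)}
    (h : ∀ α, ∀ (r : R) (hr : r ∈ filtGE I α), Ogr.cls α r hr ∈ M) (x : Ogr I) : x ∈ M :=
  Ogr.supported_le (U := Set.univ) (fun α _ => h α) (fun α hα => absurd (Set.mem_univ α) hα)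

theorem Ogr.mem_grade_iff {α : ℚ≥0} {x : Ogr I} :
    x ∈ Ogr.grade I α ↔ x ∈ Ogr.supported I {α} := by
  constructor
  · rintro ⟨p, rfl⟩
    exact Ogr.of_mem_supported (Set.mem_singleton α) p
  · refine fun hx => Ogr.supported_le ?_ hx
    rintro β rfl r hr
    exact ⟨_, rfl⟩

theorem Ogr.eq_zero_of_mem_supported_of_disjoint {U V : Set ℚ≥0} (h : Disjoint U V) {x : Ogr I}
    (hU : x ∈ Ogr.supported I U) (hV : x ∈ Ogr.supported I V) : x = 0 := by
  rw [← AddSubgroup.mem_bot]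
  refine Ogr.mem_of_forall_of_component_mem fun α => ?_
  by_cases hα : α ∈ U
  · rw [hV α (Set.disjoint_left.mp h hα), map_zero, AddSubgroup.mem_bot]
  · rw [hU α hα, map_zero, AddSubgroup.mem_bot]

theorem Ogr.mul_mem_supported {U V W : Set ℚ≥0} (hUV : ∀ α ∈ U, ∀ β ∈ V, α + β ∈ W)
    {x y : Ogr I} (hx : x ∈ Ogr.supported I U) (hy : y ∈ Ogr.supported I V) :
    x * y ∈ Ogr.supported I W := by
  have h : Ogr.supported I U ≤ (Ogr.supported I W).comap (AddMonoidHom.mulRight y) := by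
    refine Ogr.supported_le fun α hα r hr => ?_
    have h' : Ogr.supported I V ≤
        (Ogr.supported I W).comap (AddMonoidHom.mulLeft (Ogr.cls α r hr)) := by
      refine Ogr.supported_le fun β hβ s hs => ?_
      rw [AddSubgroup.mem_comap, AddMonoidHom.coe_mulLeft, Ogr.cls_mul_cls]
      exact Ogr.cls_mem_supported (hUV α hα β hβ) _
    exact h' hy
  exact h hx

theorem Ogr.pow_mem_supported_Ici {γ : ℚ≥0} {x : Ogr I}
    (hx : x ∈ Ogr.supported I (Set.Ici γ)) (n : ℕ) :
    x ^ n ∈ Ogr.supported I (Set.Ici (n * γ)) := by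
  induction n with
  | zero =>
    rw [Nat.cast_zero, zero_mul]
    exact Ogr.mem_supported_Ici_zero _
  | succ n ih =>
    rw [pow_succ]
    refine Ogr.mul_mem_supported (fun α hα β hβ => ?_) ih hx
    rw [Set.mem_Ici] at *
    push_cast
    rw [add_one_mul]
    exact add_le_add hα hβ

/-- Elements with the same part in the lowest degree `γ` have `n`-th powers with the same part in
degree `n γ`. -/
theorem Ogr.pow_sub_pow_mem_supported_Ioi {γ : ℚ≥0} {x y : Ogr I}
    (hx : x ∈ Ogr.supported I (Set.Ici γ)) (hy : y ∈ Ogr.supported I (Set.Ici γ))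
    (hxy : x - y ∈ Ogr.supported I (Set.Ioi γ)) (n : ℕ) :
    x ^ n - y ^ n ∈ Ogr.supported I (Set.Ioi (n * γ)) := by
  induction n with
  | zero => simp
  | succ n ih =>
    have h1 : x ^ (n + 1) - y ^ (n + 1) = (x ^ n - y ^ n) * x + y ^ n * (x - y) := by ring
    rw [h1]
    have h2 : ((n + 1 : ℕ) : ℚ≥0) * γ = n * γ + γ := by push_cast; ring
    rw [h2]
    exact add_mem
      (Ogr.mul_mem_supported (fun α hα β hβ => add_lt_add_of_lt_of_le hα hβ) ih hx)
      (Ogr.mul_mem_supported (fun α hα β hβ => add_lt_add_of_le_of_lt hα hβ)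
        (Ogr.pow_mem_supported_Ici hy n) hxy)

theorem Ogr.component_of_mul {α : ℚ≥0} (p : Piece I α) (δ : ℚ≥0) (x : Ogr I) :
    Ogr.component (α + δ) (Ogr.of I α p * x) = Piece.mul p (Ogr.component δ x) := by
  let m : Piece I δ →+ Piece I (α + δ) :=
    { toFun := Piece.mul p
      map_zero' := DirectSum.GNonUnitalNonAssocSemiring.mul_zero (A := Piece I) p
      map_add' := DirectSum.GNonUnitalNonAssocSemiring.mul_add (A := Piece I) p }
  let M : AddSubgroup (Ogr I) :=
    AddMonoidHom.eqLocus ((Ogr.component (α + δ)).comp (AddMonoidHom.mulLeft (Ogr.of I α p)))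
      (m.comp (Ogr.component δ))
  refine Ogr.mem_of_forall_of_component_mem (M := M) fun ε => ?_
  generalize Ogr.component ε x = q
  have hmul : Ogr.of I α p * Ogr.of I ε q = Ogr.of I (α + ε) (Piece.mul p q) :=
    DirectSum.of_mul_of (A := Piece I) p q
  change Ogr.component (α + δ) (Ogr.of I α p * Ogr.of I ε q) = m (Ogr.component δ (Ogr.of I ε q))
  rw [hmul]
  rcases eq_or_ne ε δ with rfl | h
  · rw [Ogr.component_of, Ogr.component_of]
    rfl
  · rw [Ogr.component_of_ne h, Ogr.component_of_ne (by simpa using h), map_zero]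

theorem Ogr.map_cls {S : Type*} [CommRing S] {J : Ideal S} (f : R →+* S) (hf : I.map f ≤ J)
    {α : ℚ≥0} {r : R} (hr : r ∈ filtGE I α) : Ogr.map f hf (Ogr.cls α r hr) =
      Ogr.cls α (f r) (le_trans hr (qbar_le_map f hf r)) :=
  Ogr.map_of f hf α ⟨r, hr⟩

theorem Ogr.component_map {S : Type*} [CommRing S] {J : Ideal S} (f : R →+* S)
    (hf : I.map f ≤ J) (α : ℚ≥0) (x : Ogr I) :
    Ogr.component α (Ogr.map f hf x) = Piece.map f hf α (Ogr.component α x) := by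
  let M : AddSubgroup (Ogr I) :=
    AddMonoidHom.eqLocus ((Ogr.component α).comp (Ogr.map f hf).toAddMonoidHom)
      ((Piece.map f hf α).comp (Ogr.component α))
  refine Ogr.mem_of_forall_of_component_mem (M := M) fun ε => ?_
  generalize Ogr.component ε x = q
  have hmap : Ogr.map f hf (Ogr.of I ε q) = Ogr.of J ε (Piece.map f hf ε q) := by
    obtain ⟨r, rfl⟩ := Piece.mk_surjective ε q
    exact Ogr.map_of f hf ε r
  change Ogr.component α (Ogr.map f hf (Ogr.of I ε q)) =
    Piece.map f hf α (Ogr.component α (Ogr.of I ε q))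
  rw [hmap]
  rcases eq_or_ne ε α with rfl | h
  · rw [Ogr.component_of, Ogr.component_of]
  · rw [Ogr.component_of_ne h, Ogr.component_of_ne h, map_zero]

variable (I) in
/-- The ring homomorphism that takes an element to its class in degree zero. -/
noncomputable def Ogr.clsZero : R →+* Ogr I where
  toFun r := Ogr.cls 0 r (mem_filtGE_zero r)
  map_one' := rfl
  map_mul' r s := by
    rw [Ogr.cls_mul_cls]
    exact Ogr.cls_congr (add_zero 0).symm rfl _ _
  map_zero' := (Ogr.cls_eq_zero_iff _).mpr (zero_mem _)
  map_add' r s := (Ogr.cls_add _ _).symm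

/-- Let `x` be a root of a monic polynomial of degree `N` whose coefficient of `X ^ i` lives in
degrees at least `(N - i) n`. Then `x` lives in degrees at least `n`: otherwise the `N`-th power of
its lowest form would vanish, and nonzero homogeneous elements are not nilpotent. -/
theorem Ogr.mem_supported_Ici_of_monic {n : ℕ} {x : Ogr I} {p : (Ogr I)[X]} (hp : p.Monic)
    (hpx : p.eval x = 0)
    (hcoeff : ∀ i < p.natDegree,
      p.coeff i ∈ Ogr.supported I (Set.Ici (((p.natDegree - i : ℕ) : ℚ≥0) * n))) :
    x ∈ Ogr.supported I (Set.Ici (n : ℚ≥0)) := by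
  rcases eq_or_ne p.natDegree 0 with hN | hN
  · rw [hp.natDegree_eq_zero.mp hN, eval_one] at hpx
    rw [← mul_one x, hpx, mul_zero]
    exact zero_mem _
  rcases Set.eq_empty_or_nonempty {α | Ogr.component α x ≠ 0} with he | hne
  · intro α _
    by_contra hα
    exact (he ▸ hα : α ∈ (∅ : Set ℚ≥0))
  obtain ⟨γ, hγ, hmin⟩ := Set.exists_min_image _ id (Ogr.finite_support x) hne
  have hxγ : x ∈ Ogr.supported I (Set.Ici γ) := fun α hα => by
    by_contra h
    exact hα (hmin α h)
  suffices h : (n : ℚ≥0) ≤ γ from fun α hα => hxγ α fun h' => hα (h.trans h')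
  by_contra! hlt
  obtain ⟨r, hr, hrx⟩ := Ogr.exists_of_eq_cls (Ogr.component γ x)
  set N := p.natDegree
  set y := Ogr.cls γ r hr
  have hxy : x - y ∈ Ogr.supported I (Set.Ioi γ) := by
    intro α hα
    rw [map_sub, ← hrx]
    rcases eq_or_ne γ α with rfl | hne
    · rw [Ogr.component_of, sub_self]
    · rw [Ogr.component_of_ne hne, sub_zero]
      exact hxγ α fun h => hα (lt_of_le_of_ne h hne)
  have hpow : x ^ N ∈ Ogr.supported I (Set.Ioi (N * γ)) := by
    have h1 : x ^ N = -∑ i ∈ Finset.range N, p.coeff i * x ^ i := by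
      rw [eval_eq_sum_range, Finset.sum_range_succ, hp.coeff_natDegree, one_mul] at hpx
      exact eq_neg_of_add_eq_zero_right hpx
    rw [h1]
    refine neg_mem (sum_mem fun i hi => ?_)
    have hi' : i < N := Finset.mem_range.mp hi
    refine Ogr.mul_mem_supported (fun α hα β hβ => ?_) (hcoeff i hi')
      (Ogr.pow_mem_supported_Ici hxγ i)
    rw [Set.mem_Ici] at hα hβ
    have h2 : (N : ℚ≥0) * γ = ((N - i : ℕ) : ℚ≥0) * γ + i * γ := by
      rw [← add_mul, ← Nat.cast_add, Nat.sub_add_cancel hi'.le]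
    rw [Set.mem_Ioi, h2]
    refine add_lt_add_of_lt_of_le (lt_of_lt_of_le ?_ hα) hβ
    exact mul_lt_mul_of_pos_left hlt (by exact_mod_cast Nat.sub_pos_of_lt hi')
  -- `y ^ N` is homogeneous of degree `N γ`, but all its components live in higher degrees.
  have hyN : y ^ N = 0 := by
    have h1 := sub_mem hpow (Ogr.pow_sub_pow_mem_supported_Ioi hxγ
      (Ogr.cls_mem_supported Set.self_mem_Ici hr) hxy N)
    rw [sub_sub_cancel] at h1
    refine Ogr.eq_zero_of_mem_supported_of_disjoint (U := {(N : ℚ≥0) * γ}) ?_ ?_ h1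
    · simp
    · rw [Ogr.cls_pow]
      exact Ogr.cls_mem_supported (Set.mem_singleton _) _
  rw [Ogr.cls_pow, Ogr.cls_eq_zero_iff] at hyN
  have hy : y = 0 := (Ogr.cls_eq_zero_iff hr).mpr (mem_filtGT_of_pow_mem hN hyN)
  refine hγ ?_
  rw [← Ogr.component_of γ (Ogr.component γ x), hrx, hy, map_zero]

end

/-! ### Localizing at the initial form of `b` -/

/-- If `f : G → H` becomes an isomorphism after inverting `β` and `f β` is a nonzerodivisor, then
`H` embeds into `G[β⁻¹]` over `G`. -/
theorem exists_lift_away {G H : Type*} [CommRing G] [CommRing H] (f : G →+* H) (β : G)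
    (hreg : ∀ (k : ℕ) (x : H), f β ^ k * x = 0 → x = 0)
    (hker : ∀ g, f g = 0 → ∃ k : ℕ, β ^ k * g = 0)
    (hsurj : ∀ h, ∃ (k : ℕ) (g : G), f β ^ k * h = f g) :
    ∃ ψ : H →+* Localization.Away β, Function.Injective ψ ∧
      ψ.comp f = algebraMap G (Localization.Away β) := by
  let L := Localization.Away (f β)
  let _ : Algebra G L := ((algebraMap H L).comp f).toAlgebra
  have halg : ∀ g, algebraMap G L g = algebraMap H L (f g) := fun _ => rfl
  have hinj : Function.Injective (algebraMap H L) := by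
    rw [injective_iff_map_eq_zero]
    intro x hx
    obtain ⟨⟨_, k, rfl⟩, hk⟩ :=
      (IsLocalization.map_eq_zero_iff (Submonoid.powers (f β)) L x).mp hx
    exact hreg k x hk
  -- Inverting `f β` in `H` is a localization of `G` at `β`.
  have hloc : IsLocalization (Submonoid.powers β) L := by
    refine ⟨?_, ?_, ?_⟩
    · rintro ⟨_, k, rfl⟩
      rw [halg, map_pow, map_pow]
      exact (IsLocalization.Away.algebraMap_isUnit (f β)).pow k
    · intro z
      obtain ⟨n, h, hz⟩ := IsLocalization.Away.surj (f β) z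
      obtain ⟨k, g, hg⟩ := hsurj h
      refine ⟨⟨g, ⟨β ^ (n + k), n + k, rfl⟩⟩, ?_⟩
      change z * algebraMap G L (β ^ (n + k)) = algebraMap G L g
      rw [halg, halg, ← hg, map_mul, ← hz, map_pow, map_pow, map_pow, pow_add]
      ring
    · intro x y hxy
      have h0 : f (x - y) = 0 := by
        rw [map_sub, sub_eq_zero]
        exact hinj hxy
      obtain ⟨k, hk⟩ := hker _ h0
      exact ⟨⟨β ^ k, k, rfl⟩, sub_eq_zero.mp ((mul_sub _ _ _).symm.trans hk)⟩
  let e := IsLocalization.algEquiv (Submonoid.powers β) L (Localization.Away β)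
  refine ⟨(e : L →+* Localization.Away β).comp (algebraMap H L), e.injective.comp hinj, ?_⟩
  ext g
  exact e.commutes g

section
variable {A : Type*} [CommRing A] (b : A)

theorem pow_mem_filtGE_span (k : ℕ) : b ^ k ∈ filtGE (Ideal.span {b}) (k : ℚ≥0) := by
  rw [mem_filtGE]
  simpa using div_le_qbar (I := Ideal.span {b}) (r := b ^ k) (m := 1) (p := k) one_pos
    (mem_span_singleton_pow.mpr (by simp))

theorem Ogr.initial_pow (k : ℕ) :
    Ogr.initial b ^ k = Ogr.cls (k : ℚ≥0) (b ^ k) (pow_mem_filtGE_span b k) := by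
  rw [Ogr.initial, ← Ogr.cls, Ogr.cls_pow]
  exact Ogr.cls_congr (mul_one _) rfl _ _

theorem Ogr.map_initial : Ogr.map (toICAway b) (map_span_le_toICAway b) (Ogr.initial b) =
    Ogr.initial (toICAway b b) :=
  Ogr.map_cls _ _ _

theorem toICAway_pow_mul_mem_filtGE_iff {k : ℕ} {α : ℚ≥0} {s : ICAway b} :
    toICAway b b ^ k * s ∈ filtGE (Ideal.span {toICAway b b}) (k + α) ↔
      s ∈ filtGE (Ideal.span {toICAway b b}) α := by
  rw [mem_filtGE, mem_filtGE, qbar_toICAway_pow_mul]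
  push_cast
  exact ENNReal.add_le_add_iff_left (ENNReal.natCast_ne_top k)

theorem toICAway_pow_mul_mem_filtGT_iff {k : ℕ} {α : ℚ≥0} {s : ICAway b} :
    toICAway b b ^ k * s ∈ filtGT (Ideal.span {toICAway b b}) (k + α) ↔
      s ∈ filtGT (Ideal.span {toICAway b b}) α := by
  rw [mem_filtGT, mem_filtGT, qbar_toICAway_pow_mul]
  push_cast
  exact ENNReal.add_lt_add_iff_left (ENNReal.natCast_ne_top k)

/-- Multiplication by a power of the initial form of `b` is injective on the graded pieces of the
integral closure. -/
theorem Ogr.mem_supported_of_initial_pow_mul {k : ℕ}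
    {x : Ogr (Ideal.span {toICAway b b})} {U : Set ℚ≥0}
    (hx : Ogr.initial (toICAway b b) ^ k * x ∈ Ogr.supported _ U) :
    x ∈ Ogr.supported _ {α | (k : ℚ≥0) + α ∈ U} := by
  intro α hα
  have h1 := hx (k + α) hα
  rw [Ogr.initial_pow, Ogr.cls, Ogr.component_of_mul] at h1
  obtain ⟨⟨s, hs⟩, hsx⟩ := Piece.mk_surjective α (Ogr.component α x)
  rw [← hsx, Piece.mul_mk, Piece.mk_eq_zero_iff] at h1
  rw [← hsx, Piece.mk_eq_zero_iff]
  exact (toICAway_pow_mul_mem_filtGT_iff b).mp h1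

theorem Ogr.eq_zero_of_initial_pow_mul_eq_zero (k : ℕ) (x : Ogr (Ideal.span {toICAway b b}))
    (hx : Ogr.initial (toICAway b b) ^ k * x = 0) : x = 0 := by
  refine Ogr.eq_zero_of_mem_supported_of_disjoint (U := ∅) (V := ∅) (by simp) ?_ ?_ <;>
  exact Ogr.mem_supported_of_initial_pow_mul b (k := k) (U := ∅) (hx ▸ zero_mem _)

variable [IsNoetherianRing A]

/-- The kernel of the map to the integral closure is `b`-power torsion on graded rings. -/
theorem Ogr.exists_initial_pow_mul_eq_zero {g : Ogr (Ideal.span {b})}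
    (hg : Ogr.map (toICAway b) (map_span_le_toICAway b) g = 0) :
    ∃ k : ℕ, Ogr.initial b ^ k * g = 0 := by
  obtain ⟨K, hK⟩ := exists_forall_add_qbar_le b
  refine ⟨K, ?_⟩
  suffices h : g ∈ (AddMonoidHom.mulLeft (Ogr.initial b ^ K)).ker from h
  refine Ogr.mem_of_forall_of_component_mem fun α => ?_
  have h1 := Ogr.component_map (toICAway b) (map_span_le_toICAway b) α g
  obtain ⟨⟨r, hr⟩, hrg⟩ := Piece.mk_surjective α (Ogr.component α g)
  rw [hg, map_zero, ← hrg, Piece.map_mk, eq_comm, Piece.mk_eq_zero_iff, mem_filtGT] at h1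
  rw [← hrg, ← Ogr.cls, AddMonoidHom.mem_ker, AddMonoidHom.coe_mulLeft, Ogr.initial_pow,
    Ogr.cls_mul_cls, Ogr.cls_eq_zero_iff, mem_filtGT]
  refine lt_of_lt_of_le ?_ (hK r)
  push_cast
  exact (ENNReal.add_lt_add_iff_left (ENNReal.natCast_ne_top K)).mpr h1

/-- Up to a power of `b`, a homogeneous element of the balanced associated graded ring of the
integral closure comes from a homogeneous element over `A`. -/
theorem Ogr.exists_initial_pow_mul_cls_eq {α : ℚ≥0} {s : ICAway b}
    (hs : s ∈ filtGE (Ideal.span {toICAway b b}) α) :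
    ∃ (k : ℕ) (r : A) (hr : r ∈ filtGE (Ideal.span {b}) (k + α)),
      Ogr.initial (toICAway b b) ^ k * Ogr.cls α s hs =
        Ogr.map (toICAway b) (map_span_le_toICAway b) (Ogr.cls (k + α) r hr) := by
  obtain ⟨K, hK⟩ := exists_forall_add_qbar_le b
  obtain ⟨j, r, hj⟩ := exists_pow_mul_eq_toICAway b s
  have hr : b ^ K * r ∈ filtGE (Ideal.span {b}) ((K + j : ℕ) + α) := by
    rw [mem_filtGE]
    refine le_trans ?_ (hK r)
    rw [← hj, qbar_toICAway_pow_mul]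
    push_cast
    rw [add_assoc]
    gcongr
    exact hs
  refine ⟨K + j, b ^ K * r, hr, ?_⟩
  rw [Ogr.map_cls, Ogr.initial_pow, Ogr.cls_mul_cls]
  refine Ogr.cls_congr rfl ?_ _ _
  rw [map_mul, ← hj, map_pow, pow_add, mul_assoc]

theorem Ogr.exists_initial_pow_mul_eq_map_of_mem_grade {α : ℚ≥0}
    {h : Ogr (Ideal.span {toICAway b b})} (hh : h ∈ Ogr.grade _ α) :
    ∃ (k : ℕ) (g : Ogr (Ideal.span {b})), g ∈ Ogr.grade _ (α + k) ∧
      Ogr.initial (toICAway b b) ^ k * h =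
        Ogr.map (toICAway b) (map_span_le_toICAway b) g := by
  obtain ⟨p, rfl⟩ := hh
  obtain ⟨s, hs, hp⟩ := Ogr.exists_of_eq_cls p
  obtain ⟨k, r, hr, heq⟩ := Ogr.exists_initial_pow_mul_cls_eq b hs
  refine ⟨k, Ogr.cls (k + α) r hr, ?_, hp ▸ heq⟩
  rw [add_comm]
  exact ⟨_, rfl⟩

theorem Ogr.exists_initial_pow_mul_eq_map (h : Ogr (Ideal.span {toICAway b b})) :
    ∃ (k : ℕ) (g : Ogr (Ideal.span {b})), Ogr.initial (toICAway b b) ^ k * h =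
      Ogr.map (toICAway b) (map_span_le_toICAway b) g := by
  let f := Ogr.map (toICAway b) (map_span_le_toICAway b)
  let M : AddSubgroup (Ogr (Ideal.span {toICAway b b})) :=
    { carrier := {h | ∃ (k : ℕ) (g : Ogr (Ideal.span {b})),
        Ogr.initial (toICAway b b) ^ k * h = f g}
      zero_mem' := ⟨0, 0, by simp⟩
      add_mem' := by
        rintro x y ⟨k, g, hx⟩ ⟨l, g', hy⟩
        refine ⟨k + l, Ogr.initial b ^ l * g + Ogr.initial b ^ k * g', ?_⟩
        rw [map_add, map_mul, map_mul, ← hx, ← hy, map_pow, map_pow, Ogr.map_initial]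
        ring
      neg_mem' := by
        rintro x ⟨k, g, hx⟩
        exact ⟨k, -g, by rw [map_neg, ← hx, mul_neg]⟩ }
  refine Ogr.mem_of_forall_cls_mem (M := M) (fun α s hs => ?_) h
  obtain ⟨k, r, hr, heq⟩ := Ogr.exists_initial_pow_mul_cls_eq b hs
  exact ⟨k, _, heq⟩

/-- In the balanced associated graded ring of the integral closure, an element that lives in
degrees at least `n` is divisible by the `n`-th power of the initial form of `b`. -/
theorem Ogr.exists_eq_initial_pow_mul {n : ℕ} {x : Ogr (Ideal.span {toICAway b b})}
    (hx : x ∈ Ogr.supported _ (Set.Ici (n : ℚ≥0))) :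
    ∃ y, x = Ogr.initial (toICAway b b) ^ n * y := by
  suffices h : x ∈ (AddMonoidHom.mulLeft (Ogr.initial (toICAway b b) ^ n)).range from
    h.imp fun y hy => hy.symm
  refine Ogr.supported_le (fun α hα s hs => ?_) hx
  obtain ⟨α, rfl⟩ := exists_add_of_le (Set.mem_Ici.mp hα)
  obtain ⟨t, rfl⟩ := exists_eq_toICAway_pow_mul b (s := s) (k := n) (by
    refine le_trans ?_ (mem_filtGE.mp hs)
    push_cast
    exact le_self_add)
  refine ⟨Ogr.cls α t ((toICAway_pow_mul_mem_filtGE_iff b).mp hs), ?_⟩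
  rw [AddMonoidHom.coe_mulLeft, Ogr.initial_pow, Ogr.cls_mul_cls]

/-- The balanced associated graded ring of the integral closure is integral over that of `A`. -/
theorem Ogr.map_toICAway_isIntegral :
    (Ogr.map (toICAway b) (map_span_le_toICAway b)).IsIntegral := by
  set f := Ogr.map (toICAway b) (map_span_le_toICAway b) with hf
  let _ := f.toAlgebra
  intro x
  refine Ogr.mem_of_forall_cls_mem
    (M := (integralClosure (Ogr (Ideal.span {b}))
      (Ogr (Ideal.span {toICAway b b}))).toSubring.toAddSubgroup) (fun α s hs => ?_) x
  change IsIntegral (Ogr (Ideal.span {b})) _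
  -- With `α = p / m`, the `m`-th power of the class of `s` is `b ^ p` times a class of degree zero.
  have hα : (α.den : ℚ≥0) * α = (α.num : ℕ) := by
    rw [mul_comm, NNRat.mul_den_eq_num]
  have hpow : s ^ α.den ∈ filtGE (Ideal.span {toICAway b b}) ((α.num : ℕ) : ℚ≥0) :=
    hα ▸ pow_mem_filtGE hs α.den
  obtain ⟨t, ht⟩ := exists_eq_toICAway_pow_mul b (s := s ^ α.den) (k := α.num) (by
    simpa [mem_filtGE] using hpow)
  refine IsIntegral.of_pow α.den_pos ?_
  have heq : Ogr.cls α s hs ^ α.den =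
      f (Ogr.initial b ^ α.num) * Ogr.clsZero (Ideal.span {toICAway b b}) t := by
    rw [map_pow, hf, Ogr.map_initial, Ogr.initial_pow, Ogr.cls_pow]
    change _ = _ * Ogr.cls 0 t _
    rw [Ogr.cls_mul_cls]
    exact Ogr.cls_congr (by rw [hα, add_zero]) ht _ _
  rw [heq]
  refine IsIntegral.mul isIntegral_algebraMap ?_
  obtain ⟨p, hp, hpt⟩ := (mem_ICAway_iff_isIntegral b).mp t.2
  have hpt' : eval₂ (toICAway b) t p = 0 := by
    refine Subtype.ext ?_
    have := hom_eval₂ p (toICAway b) (ICAway b).subtype t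
    exact this.trans hpt
  refine ⟨p.map (Ogr.clsZero (Ideal.span {b})), hp.map _, ?_⟩
  have hcomp : (algebraMap (Ogr (Ideal.span {b})) (Ogr (Ideal.span {toICAway b b}))).comp
      (Ogr.clsZero (Ideal.span {b})) = (Ogr.clsZero _).comp (toICAway b) := by
    ext r
    exact Ogr.map_cls _ _ _
  rw [eval₂_map, hcomp, ← hom_eval₂, hpt', map_zero]

/-- The balanced associated graded ring of the integral closure is integrally closed after
inverting `b`. -/
theorem Ogr.mem_range_of_isIntegral {ψ : Ogr (Ideal.span {toICAway b b}) →+* OgrAway b}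
    (hψ : Function.Injective ψ)
    (hcomp : ψ.comp (Ogr.map (toICAway b) (map_span_le_toICAway b)) = ogrToAway b)
    {z : OgrAway b} (hz : IsIntegral (Ogr (Ideal.span {b})) z) : z ∈ ψ.range := by
  set f := Ogr.map (toICAway b) (map_span_le_toICAway b)
  set β := Ogr.initial (toICAway b b)
  have hψf : ∀ g, ψ (f g) = ogrToAway b g := fun g => RingHom.congr_fun hcomp g
  obtain ⟨p, hp, hpz⟩ := hz
  obtain ⟨n, g, hg⟩ := IsLocalization.Away.surj (Ogr.initial b) z
  have hβ : ψ β = ogrToAway b (Ogr.initial b) := by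
    rw [← hψf, Ogr.map_initial]
  have hzβ : ψ (β ^ n) * z = ψ (f g) := by
    rw [map_pow, hβ, hψf, mul_comm]
    exact hg
  -- The monic polynomial with root `β ^ n z`, whose coefficient of `X ^ i` is a multiple of
  -- `(β ^ n) ^ (N - i)`.
  set q := (p.map f).scaleRoots (β ^ n) with hq
  have hqm : q.Monic := (monic_scaleRoots_iff _).mpr (hp.map f)
  have hqroot : q.eval (f g) = 0 := by
    refine hψ ?_
    rw [map_zero, ← eval₂_hom, ← hzβ, hq, scaleRoots_eval₂_mul, eval₂_map, hcomp, hpz, mul_zero]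
  have hmem := Ogr.mem_supported_Ici_of_monic (n := n) hqm hqroot fun i hi => by
    rw [natDegree_scaleRoots] at hi ⊢
    rw [hq, coeff_scaleRoots, ← pow_mul, Ogr.initial_pow]
    refine Ogr.mul_mem_supported (fun α hα δ hδ => ?_) (Ogr.mem_supported_Ici_zero _)
      (Ogr.cls_mem_supported (Set.mem_singleton _) _)
    rw [Set.mem_singleton_iff.mp hδ, Set.mem_Ici, Nat.cast_mul, mul_comm]
    exact le_add_self
  obtain ⟨y, hy⟩ := Ogr.exists_eq_initial_pow_mul b hmem
  refine ⟨y, ?_⟩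
  have hu : IsUnit (ψ (β ^ n)) := by
    rw [map_pow, hβ]
    exact (isUnit_algebraMap_away _).pow n
  refine hu.mul_left_cancel ?_
  rw [hzβ, ← map_mul, ← hy]

end

end BalancedGr

theorem mainTheorem7 {R : Type*} [CommRing R] [IsNoetherianRing R] (b : R) :
    ∃ φ : BalancedGr.Ogr (Ideal.span {BalancedGr.toICAway b b}) ≃+*
        BalancedGr.ICAway (BalancedGr.Ogr.initial b),
      (∀ (α : ℚ≥0) (x : BalancedGr.Ogr (Ideal.span {BalancedGr.toICAway b b})),
        x ∈ BalancedGr.Ogr.grade (Ideal.span {BalancedGr.toICAway b b}) α ↔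
          (φ x : BalancedGr.OgrAway b) ∈ BalancedGr.awayGrade b α) ∧
      (φ : BalancedGr.Ogr (Ideal.span {BalancedGr.toICAway b b}) →+*
          BalancedGr.ICAway (BalancedGr.Ogr.initial b)).comp
        (BalancedGr.Ogr.map (BalancedGr.toICAway b) (BalancedGr.map_span_le_toICAway b)) =
          BalancedGr.toICAway (BalancedGr.Ogr.initial b) := by
  open BalancedGr in
  set f := Ogr.map (toICAway b) (map_span_le_toICAway b)
  have hfβ : f (Ogr.initial b) = Ogr.initial (toICAway b b) := Ogr.map_initial b
  obtain ⟨ψ, hψ, hcomp⟩ := exists_lift_away f (Ogr.initial b)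
    (fun k x hx => Ogr.eq_zero_of_initial_pow_mul_eq_zero b k x (hfβ ▸ hx))
    (fun g hg => Ogr.exists_initial_pow_mul_eq_zero b hg)
    (fun h => hfβ ▸ Ogr.exists_initial_pow_mul_eq_map b h)
  have hψf : ∀ g, ψ (f g) = ogrToAway b g := fun g => RingHom.congr_fun hcomp g
  have hmem : ∀ x, ψ x ∈ ICAway (Ogr.initial b) := by
    intro x
    obtain ⟨p, hp, hpx⟩ := Ogr.map_toICAway_isIntegral b x
    refine (mem_ICAway_iff_isIntegral _).mpr ⟨p, hp, ?_⟩
    rw [← hcomp, ← Polynomial.hom_eval₂, hpx, map_zero]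
  let φ := RingEquiv.ofBijective (ψ.codRestrict (ICAway (Ogr.initial b)) hmem)
    ⟨fun x y hxy => hψ (congrArg Subtype.val hxy), fun z => by
      obtain ⟨x, hx⟩ :=
        Ogr.mem_range_of_isIntegral b hψ hcomp ((mem_ICAway_iff_isIntegral _).mp z.2)
      exact ⟨x, Subtype.ext hx⟩⟩
  have hφ : ∀ x, (φ x : OgrAway b) = ψ x := fun _ => rfl
  refine ⟨φ, fun α x => ?_, ?_⟩
  · rw [hφ]
    constructor
    · intro hx
      obtain ⟨k, g, hg, heq⟩ := Ogr.exists_initial_pow_mul_eq_map_of_mem_grade b hx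
      refine ⟨k, g, hg, ?_⟩
      rw [← hψf, ← hψf, ← map_pow, ← map_mul, hfβ, mul_comm, heq]
    · rintro ⟨k, g, hg, heq⟩
      rw [← hψf, ← hψf, ← map_pow, ← map_mul, hfβ, mul_comm] at heq
      have hgrade : f g ∈ Ogr.grade _ (α + k) := by
        obtain ⟨p, rfl⟩ := hg
        obtain ⟨r, hr, hp⟩ := Ogr.exists_of_eq_cls p
        rw [hp, Ogr.map_cls]
        exact ⟨_, rfl⟩
      rw [← hψ heq, Ogr.mem_grade_iff] at hgrade
      rw [Ogr.mem_grade_iff]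
      convert Ogr.mem_supported_of_initial_pow_mul b hgrade using 2
      ext δ
      simp [add_comm α]
  · exact RingHom.ext fun g => Subtype.ext (hψf g)
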